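/- Let $\Gamma$ be a simple graph with vertex set $I$. For each $i\in I$ let $(W_i,S_i)$ be a Coxeter system with Coxeter matrix $m_i$ and let $\mathcal B_i$ be a building of type $(W_i,S_i)$. Put $S=\bigsqcup_{i\in I}S_i$ and let $\widetilde W=\prod_\Gamma W_i$ be the graph product of the $W_i$, i.e. the Coxeter group with generating set $S$ and matrix $\tilde m(s,t)=m_i(s,t)$ if $s,t\in S_i$, and, for $s\in S_i$, $t\in S_j$ with $i\ne j$, $\tilde m(s,t)=2$ if $\{i,j\}$ is an edge of $\Gamma$ and $\tilde m(s,t)=\infty$ otherwise. Let $K'$ be the Davis chamber of $(\widetilde W,S)$ (the order complex of the poset of subsets $T\subseteq S$ generating a finite subgroup, with $s$-mirror spanned by the $T$ containing $s$). Let $\mathcal B=\prod_I\mathcal B_i$, with componentwise distance $\delta$ in $\prod_I W_i$, and let $\mathcal U(\mathcal B,K')$ be its $K'$-realization, i.e. the complex obtained from the disjoint union of the copies $\{C\}\times K'$, $C\in\mathcal B$, by identifying the vertex $T$ of $\{C\}\times K'$ with the vertex $T$ of $\{D\}\times K'$ (and correspondingly for simplices) whenever $\delta(C,D)$ lies in the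 subgroup generated by $T$. The graph product of buildings $\widetilde{\mathcal B}=\prod_\Gamma\mathcal B_i$ has as chambers the copies of $K'$ in the universal cover of $\mathcal U(\mathcal B,K')$ (of the component of a chosen base chamber, if $I$ is infinite); two chambers are $s$-equivalent ($s\in S$) if they share their $s$-mirror. For $T\subseteq S$, two chambers lie in the same $T$-residue if they are joined by a sequence of chambers in which consecutive members are $s$-equivalent for some $s\in T$. For a chamber $C_0$ of $\widetilde{\mathcal B}$ and $n\ge 0$, let the combinatorial ball $D_n(C_0)$ be the set of chambers at distance less than $n$ from $C_0$ in the right-angled building underlying $\widetilde{\mathcal B}$, i.e. the chambers $C$ for which there are $k<n$ and chambers $C_0,C_1,\dots,C_k=C$ such that, for each $1\le m\le k$, the chambers $C_{m-1}$ and $C_m$ lie in a common $S_i$-residue for some $i\in I$. An automorphism of $\widetilde{\mathcal B}$ (respectively of $D_n(C_0)$) is a bijection of the set of chambers $\widetilde{\mathcal B}$ (respectively $D_n(C_0)$) onto itself that preserves $s$-equivalence in both directions for every $s\in S$. Then every automorphism $g$ of a combinatorial ball $D_n(C_0)$ extends to an automorphism of $\widetilde{\mathcal B}$: there is an automorphism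 $f$ of $\widetilde{\mathcal B}$ with $f(C)=g(C)$ for all $C\in D_n(C_0)$. -/

import Mathlib

/-! ### Buildings -/

/-- A building of type `(W, S)` (given by a Coxeter system `cs`) with set of chambers `B`:
a `W`-valued distance satisfying the axioms (WD1), (WD2), (WD3). -/
structure Building {S W : Type*} [Group W] {M : CoxeterMatrix S} (cs : CoxeterSystem M W)
    (B : Type*) where
  δ : B → B → W
  nonempty : Nonempty B
  wd1 : ∀ C D : B, δ C D = 1 ↔ C = D
  wd2 : ∀ (C D C' : B) (s : S), δ C' C = cs.simple s →
    δ C' D = cs.simple s * δ C D ∨ δ C' D = δ C D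
  wd2_length : ∀ (C D C' : B) (s : S), δ C' C = cs.simple s →
    cs.length (cs.simple s * δ C D) = cs.length (δ C D) + 1 → δ C' D = cs.simple s * δ C D
  wd3 : ∀ (C D : B) (s : S), ∃ C' : B, δ C' C = cs.simple s ∧ δ C' D = cs.simple s * δ C D

/-! ### Chamber systems: residues and automorphisms -/

namespace ChamberSystem

/-- `InResidue r T C D`: the chambers `C`, `D` lie in the same `T`-residue, i.e. they are joined by
a gallery all of whose adjacencies have type in `T`; `r s` is the relation of `s`-equivalence. -/
def InResidue {S X : Type*} (r : S → X → X → Prop) (T : Set S) : X → X → Prop :=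
  Relation.ReflTransGen fun C D => ∃ s ∈ T, r s C D

/-- The type preserving automorphisms of a set of chambers `X` with `s`-equivalences `r s`: the
bijections of `X` that preserve, in both directions, `s`-equivalence for every `s`; in other words,
that map `s`-panels onto `s`-panels. -/
def aut {S X : Type*} (r : S → X → X → Prop) : Subgroup (Equiv.Perm X) where
  carrier := {g | ∀ s C D, r s C D ↔ r s (g C) (g D)}
  one_mem' := fun _ _ _ => Iff.rfl
  mul_mem' := fun {g h} hg hh s C D => (hh s C D).trans (hg s (h C) (h D))
  inv_mem' := fun {g} hg s C D => by
    have h := hg s (g⁻¹ C) (g⁻¹ D)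
    simpa using h.symm

end ChamberSystem

/-! ### The universal cover of a simplicial complex, through edge paths -/

namespace SimplicialCover

/-- Edge paths in a simplicial complex: consecutive vertices span a simplex (an edge, or a single
vertex if they coincide). -/
inductive EdgePath {V : Type*} [DecidableEq V] (K : AbstractSimplicialComplex V) (x : V) : V → Type _
  | nil : EdgePath K x x
  | snoc {y z : V} (γ : EdgePath K x y) (h : ({y, z} : Finset V) ∈ K.faces) : EdgePath K x z

/-- Elementary homotopies of edge paths with fixed end points: an edge path `… y z w` may be
replaced by `… y w` if `y, z, w` span a simplex, and a constant step `y y` may be deleted; these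
moves may take place anywhere in the path. -/
inductive EdgePath.Step {V : Type*} [DecidableEq V] {K : AbstractSimplicialComplex V} {x : V} :
    ∀ {y : V}, EdgePath K x y → EdgePath K x y → Prop
  | const {y : V} (γ : EdgePath K x y) (h : ({y, y} : Finset V) ∈ K.faces) :
      EdgePath.Step (γ.snoc h) γ
  | triangle {y z w : V} (γ : EdgePath K x y) (hyz : ({y, z} : Finset V) ∈ K.faces)
      (hzw : ({z, w} : Finset V) ∈ K.faces) (hyw : ({y, w} : Finset V) ∈ K.faces)
      (hyzw : ({y, z, w} : Finset V) ∈ K.faces) :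
      EdgePath.Step ((γ.snoc hyz).snoc hzw) (γ.snoc hyw)
  | snoc {y z : V} {γ γ' : EdgePath K x y} (hγ : EdgePath.Step γ γ')
      (h : ({y, z} : Finset V) ∈ K.faces) : EdgePath.Step (γ.snoc h) (γ'.snoc h)

/-- Homotopy classes of edge paths from `x` to `y` (`Quot` is the quotient by the equivalence
relation that the elementary homotopies generate). -/
def PathClass {V : Type*} [DecidableEq V] (K : AbstractSimplicialComplex V) (x y : V) : Type _ :=
  Quot (EdgePath.Step (K := K) (x := x) (y := y))

/-- Continue a class of edge paths along one more edge. -/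
def PathClass.snoc {V : Type*} [DecidableEq V] {K : AbstractSimplicialComplex V} {x y z : V}
    (α : PathClass K x y) (h : ({y, z} : Finset V) ∈ K.faces) : PathClass K x z :=
  Quot.map (fun γ => EdgePath.snoc γ h) (fun _ _ hγ => EdgePath.Step.snoc hγ h) α

/-- The vertices of the universal cover of (the component of `x` in) `K`: homotopy classes of edge
paths that start at the base vertex `x`. The covering map sends a class to its end point. -/
def UniversalCover {V : Type*} [DecidableEq V] (K : AbstractSimplicialComplex V) (x : V) : Type _ :=
  Σ y : V, PathClass K x y

end SimplicialCover

/-! ### Davis chambers and realizations -/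

namespace Realization

/-- The poset of spherical subsets: the `T ⊆ S` whose special subgroup `W_T` is finite. -/
abbrev Spherical {S : Type*} (M : CoxeterMatrix S) : Type _ :=
  {T : Set S // (Subgroup.closure (M.simple '' T) : Set M.Group).Finite}

/-- The empty spherical subset; it is the cone point of the Davis chamber. -/
def Spherical.empty {S : Type*} (M : CoxeterMatrix S) : Spherical M :=
  ⟨∅, by simp⟩

/-- The Davis chamber: the order complex of the poset of spherical subsets. Its `s`-mirror is the
full subcomplex on the vertices `T` with `s ∈ T`. -/
def davisChamber {S : Type*} (M : CoxeterMatrix S) : AbstractSimplicialComplex (Spherical M) where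
  faces := {c | c.Nonempty ∧ IsChain (· ≤ ·) (c : Set (Spherical M))}
  isRelLowerSet_faces := fun _ hc =>
    ⟨hc.1, fun _ hd hne => ⟨hne, hc.2.mono (Finset.coe_subset.mpr hd)⟩⟩
  singleton_mem := fun T => ⟨Finset.singleton_nonempty T, by simp⟩

/-- Vertices of the realization `(B × K') / ∼`: a vertex `T` of `K'` lies in exactly the mirrors
of the `s ∈ T`, so `(C, T)` and `(D, T)` are identified iff `δ(C, D) ∈ W_T`. Here `δ` is a `W`-valued
distance on `B`, `σ s ∈ W` are the generators, and `K'` is the Davis chamber of a Coxeter matrix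
`M'` over the same index set `S`. -/
def Vertex {S W B : Type*} [Group W] (M' : CoxeterMatrix S) (σ : S → W) (δ : B → B → W) : Type _ :=
  Quot fun x y : B × Spherical M' =>
    x.2 = y.2 ∧ δ x.1 y.1 ∈ Subgroup.closure (σ '' (x.2 : Set S))

/-- The vertex `T` of the copy of `K'` that belongs to the chamber `C`. -/
def vertex {S W B : Type*} [Group W] (M' : CoxeterMatrix S) (σ : S → W) (δ : B → B → W)
    (C : B) (T : Spherical M') : Vertex M' σ δ :=
  Quot.mk _ (C, T)

open Classical in
/-- The `K'`-realization of `(B, δ)`, as a simplicial complex: its simplices are the images of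
the simplices of the copies `{C} × K'`. -/
noncomputable def complex {S W B : Type*} [Group W] (M' : CoxeterMatrix S) (σ : S → W)
    (δ : B → B → W) : AbstractSimplicialComplex (Vertex M' σ δ) where
  faces := {F | ∃ C : B, ∃ c ∈ (davisChamber M').faces, F = c.image (vertex M' σ δ C)}
  isRelLowerSet_faces := by
    rintro F ⟨C, c, hc, rfl⟩
    refine ⟨hc.1.image _, ?_⟩
    intro G hG hne
    obtain ⟨d, hd, rfl⟩ := Finset.subset_image_iff.mp hG
    exact ⟨C, d, ((davisChamber M').isRelLowerSet_faces hc).2 hd (Finset.image_nonempty.mp hne), rfl⟩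
  singleton_mem := by
    intro v
    induction v using Quot.ind with
    | mk x => exact ⟨x.1, {x.2}, (davisChamber M').singleton_mem x.2, by simp [vertex]⟩

open Classical in
/-- In each copy of `K'` the cone point spans an edge with every vertex. -/
theorem cone_edge {S W B : Type*} [Group W] (M' : CoxeterMatrix S) (σ : S → W)
    (δ : B → B → W) (C : B) (T : Spherical M') :
    ({vertex M' σ δ C (Spherical.empty M'), vertex M' σ δ C T} : Finset (Vertex M' σ δ)) ∈
      (complex M' σ δ).faces := by
  refine ⟨C, {Spherical.empty M', T}, ⟨by simp, ?_⟩, by simp [Finset.image_insert]⟩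
  have h : Spherical.empty M' ≤ T := Set.empty_subset (T : Set S)
  rw [Finset.coe_insert, Finset.coe_singleton]
  exact IsChain.pair h

open Classical in
/-- The chambers of the universal cover of the `K'`-realization, with respect to the chamber
`base`: the copies of `K'` in the universal cover. Such a copy is given by the chamber `C` it lies
over together with its cone point, which is a point of the universal cover over the cone point
of `C`. -/
def CoverChamber {S W B : Type*} [Group W] (M' : CoxeterMatrix S) (σ : S → W)
    (δ : B → B → W) (base : B) : Type _ :=
  Σ C : B, SimplicialCover.PathClass (complex M' σ δ)
    (vertex M' σ δ base (Spherical.empty M')) (vertex M' σ δ C (Spherical.empty M'))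

open Classical in
/-- The vertex `T` of a copy of `K'` in the universal cover: go from the cone point to `T` inside
the copy. -/
noncomputable def CoverChamber.vertex {S W B : Type*} [Group W] {M' : CoxeterMatrix S} {σ : S → W}
    {δ : B → B → W} {base : B} (C : CoverChamber M' σ δ base) (T : Spherical M') :
    SimplicialCover.UniversalCover (complex M' σ δ)
      (Realization.vertex M' σ δ base (Spherical.empty M')) :=
  ⟨Realization.vertex M' σ δ C.1 T, C.2.snoc (cone_edge M' σ δ C.1 T)⟩

/-- The `s`-mirror (its set of vertices) of a copy of `K'` in the universal cover. -/
def CoverChamber.mirror {S W B : Type*} [Group W] {M' : CoxeterMatrix S} {σ : S → W}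
    {δ : B → B → W} {base : B} (s : S) (C : CoverChamber M' σ δ base) :=
  C.vertex '' {T : Spherical M' | s ∈ (T : Set S)}

/-- Two copies of `K'` are `s`-equivalent (equal or `s`-adjacent) if they share their
`s`-mirror. -/
def CoverChamber.Equivalent {S W B : Type*} [Group W] {M' : CoxeterMatrix S} {σ : S → W}
    {δ : B → B → W} {base : B} (s : S) (C D : CoverChamber M' σ δ base) : Prop :=
  C.mirror s = D.mirror s

end Realization

/-! ### Graph products -/

namespace GraphProduct

open Classical in
/-- The Coxeter matrix of the graph product of the `W_i` over the graph `Γ`, over the disjoint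
union of the `S_i` (Mathlib encodes the entry `∞` by `0`). -/
noncomputable def coxeterMatrix {I : Type*} (Γ : SimpleGraph I) {S : I → Type*}
    (M : ∀ i, CoxeterMatrix (S i)) : CoxeterMatrix (Σ i, S i) where
  M := Matrix.of fun p q =>
    if h : q.1 = p.1 then M p.1 p.2 (h ▸ q.2) else if Γ.Adj p.1 q.1 then 2 else 0
  isSymm := by
    ext ⟨i, s⟩ ⟨j, t⟩
    by_cases h : i = j
    · subst h
      simp [(M i).symmetric s t]
    · have h' : ¬ j = i := fun e => h e.symm
      simp [h, h', Γ.adj_comm]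
  diagonal := by
    rintro ⟨i, s⟩
    simp
  off_diagonal := by
    rintro ⟨i, s⟩ ⟨j, t⟩ hne
    by_cases h : j = i
    · subst h
      have hst : s ≠ t := fun e => hne (by rw [e])
      simpa using (M j).off_diagonal s t hst
    · simp only [Matrix.of_apply, h, dite_false]
      split_ifs <;> decide

open Classical in
/-- The generators of the direct product of the `W_i`. -/
noncomputable def prodSimple {I : Type*} {S W : I → Type*} [∀ i, Group (W i)]
    {M : ∀ i, CoxeterMatrix (S i)} (cs : ∀ i, CoxeterSystem (M i) (W i)) (p : Σ i, S i) :
    ∀ i, W i :=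
  Pi.mulSingle p.1 ((cs p.1).simple p.2)

/-- The distance of the product building `∏ B_i`, with values in `∏ W_i`. -/
def prodDist {I : Type*} {S W : I → Type*} [∀ i, Group (W i)]
    {M : ∀ i, CoxeterMatrix (S i)} {cs : ∀ i, CoxeterSystem (M i) (W i)} {B : I → Type*}
    (Φ : ∀ i, Building (cs i) (B i)) (C D : ∀ i, B i) : ∀ i, W i :=
  fun i => (Φ i).δ (C i) (D i)

/-- The chambers of the graph product of the buildings `B_i` over `Γ`: the copies of `K'` in the
universal cover of the `K'`-realization of `∏ B_i`, where `K'` is the Davis chamber of the graph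
product of the `W_i`. The universal cover is taken with respect to the chamber `base`. -/
abbrev Chamber {I : Type*} (Γ : SimpleGraph I) {S W : I → Type*} [∀ i, Group (W i)]
    {M : ∀ i, CoxeterMatrix (S i)} {cs : ∀ i, CoxeterSystem (M i) (W i)} {B : I → Type*}
    (Φ : ∀ i, Building (cs i) (B i)) (base : ∀ i, B i) : Type _ :=
  Realization.CoverChamber (coxeterMatrix Γ M) (prodSimple cs) (prodDist Φ) base

/-- `s`-equivalence of chambers of the graph product, for `s` in the disjoint union of the
`S_i`. -/
abbrev Equivalent {I : Type*} {Γ : SimpleGraph I} {S W : I → Type*} [∀ i, Group (W i)]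
    {M : ∀ i, CoxeterMatrix (S i)} {cs : ∀ i, CoxeterSystem (M i) (W i)} {B : I → Type*}
    {Φ : ∀ i, Building (cs i) (B i)} {base : ∀ i, B i} (s : Σ i, S i)
    (C D : Chamber Γ Φ base) : Prop :=
  Realization.CoverChamber.Equivalent s C D

/-- `i`-equivalence in the underlying right-angled building: two chambers of the graph product are
`i`-equivalent there iff they lie in the same `S_i`-residue. -/
def IEquivalent {I : Type*} {Γ : SimpleGraph I} {S W : I → Type*} [∀ i, Group (W i)]
    {M : ∀ i, CoxeterMatrix (S i)} {cs : ∀ i, CoxeterSystem (M i) (W i)} {B : I → Type*}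
    {Φ : ∀ i, Building (cs i) (B i)} {base : ∀ i, B i} (i : I)
    (C D : Chamber Γ Φ base) : Prop :=
  ChamberSystem.InResidue Equivalent {s : Σ i, S i | s.1 = i} C D

/-- The combinatorial ball with centre `C₀`: the chambers whose gallery distance from `C₀` in the
underlying right-angled building is less than `n`. -/
def ball {I : Type*} {Γ : SimpleGraph I} {S W : I → Type*} [∀ i, Group (W i)]
    {M : ∀ i, CoxeterMatrix (S i)} {cs : ∀ i, CoxeterSystem (M i) (W i)} {B : I → Type*}
    {Φ : ∀ i, Building (cs i) (B i)} {base : ∀ i, B i} (C₀ : Chamber Γ Φ base) (n : ℕ) :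
    Set (Chamber Γ Φ base) :=
  {C | ∃ k < n, ∃ c : ℕ → Chamber Γ Φ base, c 0 = C₀ ∧ c k = C ∧
    ∀ m < k, ∃ i : I, IEquivalent i (c m) (c (m + 1))}

end GraphProduct

/-! The graph product is treated as a right-angled chamber system. Every chamber has for each i a
coordinate that identifies its i-residue with a fixed set X i, residues of types joined by an edge
of Γ form squares, and each wall of type i (a residue whose type is the star of i) divides the
chambers into sectors indexed by X i. Relative to a base chamber O, every i-residue has a closest
chamber `low`. Two different descents of a chamber have types joined by an edge and commute
(`adj_of_descent`, `low_low`), and the number of separating walls is the gallery distance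
(`length_lt_iff`).

An automorphism of a ball permutes X i at every chamber whose i-residues are sure to lie in the
ball. Farther out, these local permutations are inherited from chambers closer to O, chosen so that
the result is constant along walls (`exists_portrait`). The extension f is then defined by recursion
on the length: f P arises from f of a lower neighbour by applying the permutation to one coordinate.
The choice of descent is irrelevant, because two descents span a square on whose parallel sides the
permutations agree (`exists_extension`). A map that is bijective on residues is bijective
(`bijective_of_move`).

The right-angled structure comes from the universal property of the universal cover: it maps
uniquely, once one value is prescribed, to any `Covering` (`exists_isLift`, `IsLift.eq`). Suitable
coverings yield the coordinates (`factorCovering`), sections that parametrise residues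
(`residueCovering`) and the sectors of walls (`crossingCovering`). Coordinates take values in the
universal cover of the realization of B_i, so simple connectedness of that realization is never
needed. -/

/-! ### Steps in the universal cover -/

namespace SimplicialCover

section

variable {V : Type*} [DecidableEq V] {K : AbstractSimplicialComplex V} {x : V}

/-- The end point of the lift of an edge of `K` to the universal cover, starting at `a`. -/
def UniversalCover.step (a : UniversalCover K x) (z : V) (h : ({a.1, z} : Finset V) ∈ K.faces) :
    UniversalCover K x :=
  ⟨z, a.2.snoc h⟩

theorem UniversalCover.step_congr {a b : UniversalCover K x} {z w : V}
    (ha : ({a.1, z} : Finset V) ∈ K.faces) (hb : ({b.1, w} : Finset V) ∈ K.faces)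
    (hab : a = b) (hzw : z = w) : a.step z ha = b.step w hb := by
  subst hab hzw
  rfl

theorem UniversalCover.step_self (a : UniversalCover K x) {z : V} (hz : z = a.1)
    (h : ({a.1, z} : Finset V) ∈ K.faces) : a.step z h = a := by
  obtain ⟨y, α⟩ := a
  dsimp only at hz h
  subst hz
  induction α using Quot.ind with
  | mk γ => exact congrArg (Sigma.mk z) (Quot.sound (EdgePath.Step.const γ h))

theorem UniversalCover.step_step (a : UniversalCover K x) {z w : V}
    (h : ({a.1, z} : Finset V) ∈ K.faces) (h' : ({z, w} : Finset V) ∈ K.faces)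
    (h'' : ({a.1, w} : Finset V) ∈ K.faces) (ht : ({a.1, z, w} : Finset V) ∈ K.faces) :
    (a.step z h).step w h' = a.step w h'' := by
  obtain ⟨y, α⟩ := a
  induction α using Quot.ind with
  | mk γ => exact congrArg (Sigma.mk w) (Quot.sound (EdgePath.Step.triangle γ h h' h'' ht))

theorem UniversalCover.step_back (a : UniversalCover K x) {z w : V} (hw : w = a.1)
    (h : ({a.1, z} : Finset V) ∈ K.faces) (h' : ({z, w} : Finset V) ∈ K.faces) :
    (a.step z h).step w h' = a := by
  have h1 : ({a.1, w} : Finset V) ∈ K.faces := by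
    rw [hw, Finset.pair_eq_singleton]
    exact K.singleton_mem _
  have h2 : ({a.1, z, w} : Finset V) ∈ K.faces := by
    rw [hw, Finset.pair_comm z, Finset.insert_idem]
    exact h
  rw [a.step_step h h' h1 h2, a.step_self hw]

end

end SimplicialCover

/-! ### Coverings of the realization and lifting -/

namespace Realization

open SimplicialCover

section

open Classical

variable {S W B : Type*} [Group W] {M' : CoxeterMatrix S} {σ : S → W} {δ : B → B → W} {base : B}

/-- The type of a vertex of the realization. -/
def Vertex.type : Vertex M' σ δ → Spherical M' :=
  Quot.lift (fun x => x.2) fun _ _ h => h.1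

/-- As δ is arbitrary here, vertices are identified by the equivalence relation generated by the
defining one. Along a generating chain the type is constant, and every link for T is also a link for
the larger T'. -/
theorem vertex_congr_of_le {C D : B} {T T' : Spherical M'} (hT : T ≤ T')
    (h : vertex M' σ δ C T = vertex M' σ δ D T) : vertex M' σ δ C T' = vertex M' σ δ D T' := by
  have key : ∀ x y : B × Spherical M', Relation.EqvGen (fun x y : B × Spherical M' =>
      x.2 = y.2 ∧ δ x.1 y.1 ∈ Subgroup.closure (σ '' (x.2 : Set S))) x y →
      x.2 ≤ T' → x.2 = y.2 ∧ vertex M' σ δ x.1 T' = vertex M' σ δ y.1 T' := by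
    intro x y hxy
    induction hxy with
    | rel x y h =>
      intro hx
      exact ⟨h.1, Quot.sound ⟨rfl, Subgroup.closure_mono (Set.image_mono hx) h.2⟩⟩
    | refl x => exact fun _ => ⟨rfl, rfl⟩
    | symm x y h ih =>
      intro hy
      have hx : x.2 ≤ T' := by
        by_contra hx
        have : x.2 = y.2 := congrArg Vertex.type (Quot.eqvGen_sound h)
        exact hx (this ▸ hy)
      exact ⟨(ih hx).1.symm, (ih hx).2.symm⟩
    | trans x y z _ _ ih₁ ih₂ =>
      intro hx
      have h1 := ih₁ hx
      have h2 := ih₂ (h1.1 ▸ hx)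
      exact ⟨h1.1.trans h2.1, h1.2.trans h2.2⟩
  exact (key _ _ (Quot.eqvGen_exact h) hT).2

theorem mem_faces_image {C : B} {c : Finset (Spherical M')} (hne : c.Nonempty)
    (hc : IsChain (· ≤ ·) (c : Set (Spherical M'))) :
    c.image (vertex M' σ δ C) ∈ (complex M' σ δ).faces :=
  ⟨C, c, ⟨hne, hc⟩, rfl⟩

theorem edge_mem {C : B} {T T' : Spherical M'} (h : T ≤ T' ∨ T' ≤ T) :
    ({vertex M' σ δ C T, vertex M' σ δ C T'} : Finset _) ∈ (complex M' σ δ).faces := by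
  have := mem_faces_image (M' := M') (σ := σ) (δ := δ) (C := C) (c := {T, T'}) (by simp) (by
    rw [Finset.coe_insert, Finset.coe_singleton]
    rcases h with h | h
    · exact IsChain.pair h
    · rw [Set.pair_comm]
      exact IsChain.pair h)
  simpa [Finset.image_insert] using this

theorem triangle_mem {C : B} {T T' T'' : Spherical M'} (h : T ≤ T') (h' : T' ≤ T'') :
    ({vertex M' σ δ C T, vertex M' σ δ C T', vertex M' σ δ C T''} : Finset _) ∈
      (complex M' σ δ).faces := by
  have := mem_faces_image (M' := M') (σ := σ) (δ := δ) (C := C) (c := {T, T', T''}) (by simp) (by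
    rw [Finset.coe_insert, Finset.coe_insert, Finset.coe_singleton]
    refine (IsChain.pair h').insert fun b hb _ => Or.inl ?_
    rcases hb with rfl | rfl
    · exact h
    · exact h.trans h')
  simpa [Finset.image_insert] using this

theorem exists_chamber_of_triangle {u v w : Vertex M' σ δ}
    (h : ({u, v, w} : Finset _) ∈ (complex M' σ δ).faces) :
    ∃ C : B, vertex M' σ δ C u.type = u ∧ vertex M' σ δ C v.type = v ∧
      vertex M' σ δ C w.type = w := by
  obtain ⟨C, c, -, hF⟩ := h
  have key : ∀ z ∈ ({u, v, w} : Finset (Vertex M' σ δ)), vertex M' σ δ C z.type = z := by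
    intro z hz
    rw [hF] at hz
    obtain ⟨T, -, rfl⟩ := Finset.mem_image.mp hz
    rfl
  exact ⟨C, key u (by simp), key v (by simp), key w (by simp)⟩

theorem exists_chamber_of_edge {u v : Vertex M' σ δ}
    (h : ({u, v} : Finset _) ∈ (complex M' σ δ).faces) :
    (∃ C : B, vertex M' σ δ C u.type = u ∧ vertex M' σ δ C v.type = v) ∧
      (u.type ≤ v.type ∨ v.type ≤ u.type) := by
  obtain ⟨C, c, hc, hF⟩ := h
  have key : ∀ z ∈ ({u, v} : Finset (Vertex M' σ δ)),
      vertex M' σ δ C z.type = z ∧ z.type ∈ c := by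
    intro z hz
    rw [hF] at hz
    obtain ⟨T, hT, rfl⟩ := Finset.mem_image.mp hz
    exact ⟨rfl, hT⟩
  refine ⟨⟨C, (key u (by simp)).1, (key v (by simp)).1⟩, ?_⟩
  exact hc.2.total (key u (by simp)).2 (key v (by simp)).2

/-- A set `Y` of chambers over `B`, with `T`-residues that are mapped bijectively onto the
`T`-residues of `B`, for spherical `T`. -/
structure Covering (M' : CoxeterMatrix S) (σ : S → W) (δ : B → B → W) (Y : Type*) where
  proj : Y → B
  rel : Spherical M' → Y → Y → Prop
  equiv : ∀ T, Equivalence (rel T)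
  mono : ∀ {T T' y y'}, T ≤ T' → rel T y y' → rel T' y y'
  vertex_eq : ∀ {T y y'}, rel T y y' → vertex M' σ δ (proj y) T = vertex M' σ δ (proj y') T
  lift : ∀ {T y D}, vertex M' σ δ (proj y) T = vertex M' σ δ D T → ∃ y', rel T y y' ∧ proj y' = D
  inj : ∀ {T y y'}, rel T y y' → proj y = proj y' → y = y'

/-! ### The universal cover is a connected covering -/

namespace CoverChamber

/-- The cone point of a copy of `K'` in the universal cover. -/
def point (P : CoverChamber M' σ δ base) :
    UniversalCover (complex M' σ δ) (Realization.vertex M' σ δ base (Spherical.empty M')) :=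
  ⟨Realization.vertex M' σ δ P.1 (Spherical.empty M'), P.2⟩

theorem ext_point {P Q : CoverChamber M' σ δ base} (h : P.1 = Q.1) (h' : P.point = Q.point) :
    P = Q := by
  obtain ⟨C, α⟩ := P
  obtain ⟨D, β⟩ := Q
  dsimp only at h
  subst h
  have h2 : α = β := eq_of_heq (Sigma.mk.inj h').2
  rw [h2]

theorem step_vertex_empty (P : CoverChamber M' σ δ base) (T : Spherical M')
    (h : ({(P.vertex T).1, P.point.1} : Finset _) ∈ (complex M' σ δ).faces) :
    (P.vertex T).step P.point.1 h = P.point :=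
  UniversalCover.step_back _ rfl _ _

theorem vertex_eq_step_vertex (P : CoverChamber M' σ δ base) {T T' : Spherical M'} (hT : T ≤ T') :
    P.vertex T' = (P.vertex T).step (Realization.vertex M' σ δ P.1 T') (edge_mem (Or.inl hT)) :=
  (UniversalCover.step_step P.point _ _ _ (triangle_mem (Set.empty_subset _) hT)).symm

theorem vertex_mono {P Q : CoverChamber M' σ δ base} {T T' : Spherical M'} (hT : T ≤ T')
    (h : P.vertex T = Q.vertex T) : P.vertex T' = Q.vertex T' := by
  rw [P.vertex_eq_step_vertex hT, Q.vertex_eq_step_vertex hT]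
  exact UniversalCover.step_congr _ _ h (vertex_congr_of_le hT (congrArg Sigma.fst h))

/-- The cone point of the new copy is the end of the lift, starting at the shared vertex, of the
edge from T to the cone point of D. -/
theorem exists_vertex_eq (P : CoverChamber M' σ δ base) {T : Spherical M'} {D : B}
    (h : Realization.vertex M' σ δ P.1 T = Realization.vertex M' σ δ D T) :
    ∃ Q : CoverChamber M' σ δ base, P.vertex T = Q.vertex T ∧ Q.1 = D := by
  have he : ({(P.vertex T).1, Realization.vertex M' σ δ D (Spherical.empty M')} : Finset _) ∈
      (complex M' σ δ).faces := by
    change ({Realization.vertex M' σ δ P.1 T, _} : Finset _) ∈ _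
    rw [h]
    exact edge_mem (Or.inr (Set.empty_subset _))
  refine ⟨⟨D, ((P.vertex T).step _ he).2⟩, ?_, rfl⟩
  exact (UniversalCover.step_back (P.vertex T) h.symm he (cone_edge M' σ δ D T)).symm

theorem eq_of_vertex_eq {P Q : CoverChamber M' σ δ base} {T : Spherical M'}
    (h : P.vertex T = Q.vertex T) (h' : P.1 = Q.1) : P = Q := by
  refine ext_point h' ?_
  have hP := P.step_vertex_empty T (edge_mem (Or.inr (Set.empty_subset _)))
  have hQ := Q.step_vertex_empty T (edge_mem (Or.inr (Set.empty_subset _)))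
  rw [← hP, ← hQ]
  exact UniversalCover.step_congr _ _ h
    (congrArg (fun C => Realization.vertex M' σ δ C (Spherical.empty M')) h')

variable (M' σ δ base) in
/-- The chambers of the universal cover form a covering. -/
def covering : Covering M' σ δ (CoverChamber M' σ δ base) where
  proj := Sigma.fst
  rel T P Q := P.vertex T = Q.vertex T
  equiv _ := ⟨fun _ => rfl, Eq.symm, Eq.trans⟩
  mono := vertex_mono
  vertex_eq h := congrArg Sigma.fst h
  lift {_} {P} {_} h := P.exists_vertex_eq h
  inj := eq_of_vertex_eq

variable (M' σ δ base) in
/-- The base chamber of the universal cover. -/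
def origin : CoverChamber M' σ δ base := ⟨base, Quot.mk _ EdgePath.nil⟩

/-- Every edge lies in some copy of K', so an edge path runs through copies in which consecutive
ones share a vertex. The induction over paths concerns all copies that have the end point of the
lifted path as a vertex. -/
theorem reachable (P : CoverChamber M' σ δ base) :
    Relation.ReflTransGen (fun P Q : CoverChamber M' σ δ base => ∃ T, P.vertex T = Q.vertex T)
      (origin M' σ δ base) P := by
  have key : ∀ (y : Vertex M' σ δ) (γ : EdgePath (complex M' σ δ)
      (Realization.vertex M' σ δ base (Spherical.empty M')) y) (Q : CoverChamber M' σ δ base)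
      (T : Spherical M'), Q.vertex T = ⟨y, Quot.mk _ γ⟩ →
      Relation.ReflTransGen (fun P Q : CoverChamber M' σ δ base => ∃ T, P.vertex T = Q.vertex T)
        (origin M' σ δ base) Q := by
    intro y γ
    induction γ with
    | nil =>
      intro Q T hQ
      refine Relation.ReflTransGen.single ⟨T, ?_⟩
      have hT : T = Spherical.empty M' :=
        congrArg Vertex.type (congrArg Sigma.fst hQ)
      subst hT
      rw [hQ]
      exact UniversalCover.step_self (origin M' σ δ base).point rfl _
    | @snoc y z γ h ih =>
      intro Q T hQ
      have hT : T = z.type := congrArg Vertex.type (congrArg Sigma.fst hQ)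
      obtain ⟨⟨E, hy, hz⟩, hc⟩ := exists_chamber_of_edge h
      have he : ({y, Realization.vertex M' σ δ E (Spherical.empty M')} : Finset _) ∈
          (complex M' σ δ).faces := by
        rw [← hy]
        exact edge_mem (Or.inr (Set.empty_subset _))
      let a : UniversalCover (complex M' σ δ)
        (Realization.vertex M' σ δ base (Spherical.empty M')) := ⟨y, Quot.mk _ γ⟩
      -- The copy over E through the end point of the lift of γ. It contains the lift of the next
      -- edge, hence shares with Q the vertex at its end.
      let R : CoverChamber M' σ δ base := ⟨E, (a.step _ he).2⟩
      have hR : R.vertex y.type = a := UniversalCover.step_back a hy he _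
      refine (ih R y.type hR).tail ⟨T, ?_⟩
      rw [hQ, hT]
      rcases hc with hc | hc
      · rw [R.vertex_eq_step_vertex hc]
        exact UniversalCover.step_congr _ h hR hz
      -- Here the type decreases along the edge, so the edge is first lifted in the opposite
      -- direction and then traversed back.
      · have h1 := R.vertex_eq_step_vertex hc
        have hh : ({(R.vertex y.type).1, Realization.vertex M' σ δ E z.type} : Finset _) ∈
            (complex M' σ δ).faces := by
          rw [hR, hz]
          exact h
        have h2 : (R.vertex y.type).step (Realization.vertex M' σ δ E z.type) hh =
            R.vertex z.type := by
          have hb : ({(R.vertex z.type).1, Realization.vertex M' σ δ E y.type} : Finset _) ∈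
            (complex M' σ δ).faces := edge_mem (Or.inl hc)
          rw [← UniversalCover.step_back (R.vertex z.type) (z := Realization.vertex M' σ δ E y.type)
            (w := Realization.vertex M' σ δ E z.type) rfl hb (edge_mem (Or.inr hc))]
          exact UniversalCover.step_congr _ _ h1 rfl
        rw [← h2]
        exact UniversalCover.step_congr _ h hR hz
  obtain ⟨C, α⟩ := P
  induction α using Quot.ind with
  | mk γ =>
    exact key _ γ _ (Spherical.empty M') (UniversalCover.step_self (point ⟨C, Quot.mk _ γ⟩) rfl _)

end CoverChamber

/-! ### The universal property: lifting to coverings -/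

namespace Covering

variable {Y : Type*} (𝒴 : Covering M' σ δ Y)

/-- The continuation of a set of lifts along an edge that ends at `z`. -/
def next (z : Vertex M' σ δ) (A : Set Y) : Set Y :=
  {y | ∃ y' ∈ A, vertex M' σ δ (𝒴.proj y') z.type = z ∧ 𝒴.rel z.type y' y}

/-- A residue that lies over the vertex `v`. -/
def IsClass (v : Vertex M' σ δ) (A : Set Y) : Prop :=
  ∃ y, vertex M' σ δ (𝒴.proj y) v.type = v ∧ A = {y' | 𝒴.rel v.type y y'}

variable {𝒴}

theorem IsClass.exists_mem {v : Vertex M' σ δ} {A : Set Y} (hA : 𝒴.IsClass v A) {E : B}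
    (hE : vertex M' σ δ E v.type = v) : ∃ y ∈ A, 𝒴.proj y = E := by
  obtain ⟨y, hy, rfl⟩ := hA
  exact 𝒴.lift (hy.trans hE.symm)

theorem IsClass.rel {v : Vertex M' σ δ} {A : Set Y} (hA : 𝒴.IsClass v A) {y y' : Y} (hy : y ∈ A)
    (hy' : y' ∈ A) : 𝒴.rel v.type y y' := by
  obtain ⟨z, -, rfl⟩ := hA
  exact (𝒴.equiv _).trans ((𝒴.equiv _).symm hy) hy'

theorem IsClass.eq_of_mem {v : Vertex M' σ δ} {A : Set Y} (hA : 𝒴.IsClass v A) {y : Y}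
    (hy : y ∈ A) : A = {y' | 𝒴.rel v.type y y'} := by
  obtain ⟨z, hz, rfl⟩ := hA
  ext y'
  exact ⟨fun h => (𝒴.equiv _).trans ((𝒴.equiv _).symm hy) h, fun h => (𝒴.equiv _).trans hy h⟩

/-- The continuation does not depend on the chamber chosen in A. If the type grows, this is
monotonicity. If it shrinks, a chamber of A over z is compared with the lift of its projection into
the smaller residue of y; both lie in A, so they agree by injectivity. -/
theorem IsClass.next_eq {v z : Vertex M' σ δ} {A : Set Y} (hA : 𝒴.IsClass v A)
    (h : v.type ≤ z.type ∨ z.type ≤ v.type) {y : Y} (hy : y ∈ A)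
    (hyz : vertex M' σ δ (𝒴.proj y) z.type = z) :
    𝒴.next z A = {y' | 𝒴.rel z.type y y'} := by
  ext y'
  refine ⟨?_, fun h' => ⟨y, hy, hyz, h'⟩⟩
  rintro ⟨w, hw, hwz, hwy⟩
  refine (𝒴.equiv _).trans ?_ hwy
  rcases h with h | h
  · exact 𝒴.mono h (hA.rel hy hw)
  · obtain ⟨u, hu, hup⟩ := 𝒴.lift (hyz.trans hwz.symm)
    have : u = w := 𝒴.inj ((𝒴.equiv v.type).trans ((𝒴.equiv _).symm (𝒴.mono h hu))
      (hA.rel hy hw)) hup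
    exact this ▸ hu

theorem IsClass.next {v z : Vertex M' σ δ} {A : Set Y} (hA : 𝒴.IsClass v A)
    (h : ({v, z} : Finset _) ∈ (complex M' σ δ).faces) : 𝒴.IsClass z (𝒴.next z A) := by
  obtain ⟨⟨E, hv, hz⟩, hc⟩ := exists_chamber_of_edge h
  obtain ⟨y, hy, rfl⟩ := hA.exists_mem hv
  exact ⟨y, hz, hA.next_eq hc hy hz⟩

variable (𝒴) in
/-- The lifts, starting at `y₀`, of an edge path. -/
def lifts (y₀ : Y) {x : Vertex M' σ δ} : ∀ {v : Vertex M' σ δ},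
    EdgePath (complex M' σ δ) x v → Set Y
  | _, .nil => {y | 𝒴.rel x.type y₀ y}
  | _, .snoc (z := z) γ _ => 𝒴.next z (lifts y₀ γ)

theorem isClass_lifts {y₀ : Y} {x : Vertex M' σ δ} (h₀ : vertex M' σ δ (𝒴.proj y₀) x.type = x)
    {v : Vertex M' σ δ} (γ : EdgePath (complex M' σ δ) x v) : 𝒴.IsClass v (𝒴.lifts y₀ γ) := by
  induction γ with
  | nil => exact ⟨y₀, h₀, rfl⟩
  | snoc γ h ih => exact ih.next h

/-- The vertices of a triangle lie in a common chamber E. The lift of E in the current residue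
belongs to every residue met on either route, and one member determines the residue. -/
theorem lifts_eq_of_step {y₀ : Y} {x : Vertex M' σ δ}
    (h₀ : vertex M' σ δ (𝒴.proj y₀) x.type = x) {v : Vertex M' σ δ}
    {γ γ' : EdgePath (complex M' σ δ) x v} (h : EdgePath.Step γ γ') :
    𝒴.lifts y₀ γ = 𝒴.lifts y₀ γ' := by
  induction h with
  | const γ h =>
    have hA := 𝒴.isClass_lifts h₀ γ
    obtain ⟨y, hy, hyA⟩ := id hA
    have hm : y ∈ 𝒴.lifts y₀ γ := by
      rw [hyA]
      exact (𝒴.equiv _).refl y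
    exact (hA.next_eq (Or.inl le_rfl) hm hy).trans (hA.eq_of_mem hm).symm
  | @triangle u v w γ huv hvw huw ht =>
    obtain ⟨E, hu, hv, hw⟩ := exists_chamber_of_triangle ht
    have hA := 𝒴.isClass_lifts h₀ γ
    obtain ⟨y, hy, rfl⟩ := hA.exists_mem hu
    have h1 := hA.next_eq (exists_chamber_of_edge huv).2 hy hv
    have hy' : y ∈ 𝒴.next v (𝒴.lifts y₀ γ) := by
      rw [h1]
      exact (𝒴.equiv _).refl y
    exact ((hA.next huv).next_eq (exists_chamber_of_edge hvw).2 hy' hw).trans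
      (hA.next_eq (exists_chamber_of_edge huw).2 hy hw).symm
  | snoc _ h ih => exact congrArg (𝒴.next _) ih

variable (𝒴) in
/-- A map to a covering that is compatible with projections and residues. -/
structure IsLift (F : CoverChamber M' σ δ base → Y) : Prop where
  proj : ∀ P, 𝒴.proj (F P) = P.1
  rel : ∀ {T P Q}, P.vertex T = Q.vertex T → 𝒴.rel T (F P) (F Q)

/-- By homotopy invariance, path lifting assigns a residue of Y to every vertex of the universal
cover. F P is a chamber over P.1 in the residue assigned to the cone point of P. -/
theorem exists_isLift_origin {y₀ : Y} (h₀ : 𝒴.proj y₀ = base) :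
    ∃ F : CoverChamber M' σ δ base → Y, 𝒴.IsLift F ∧ F (CoverChamber.origin M' σ δ base) = y₀ := by
  have hv : vertex M' σ δ (𝒴.proj y₀) (vertex M' σ δ base (Spherical.empty M')).type =
      vertex M' σ δ base (Spherical.empty M') := by
    rw [h₀]
    rfl
  let L : UniversalCover (complex M' σ δ) (vertex M' σ δ base (Spherical.empty M')) → Set Y :=
    fun a => Quot.lift (fun γ => 𝒴.lifts y₀ γ) (fun _ _ h => lifts_eq_of_step hv h) a.2
  have hL : ∀ a, 𝒴.IsClass a.1 (L a) := by
    rintro ⟨v, α⟩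
    induction α using Quot.ind with
    | mk γ => exact 𝒴.isClass_lifts hv γ
  have hstep : ∀ a z h, L (UniversalCover.step a z h) = 𝒴.next z (L a) := by
    rintro ⟨v, α⟩ z h
    induction α using Quot.ind with
    | mk γ => rfl
  have hex : ∀ P : CoverChamber M' σ δ base, ∃ y ∈ L P.point, 𝒴.proj y = P.1 :=
    fun P => (hL P.point).exists_mem rfl
  choose F hF hFp using hex
  refine ⟨F, ⟨hFp, ?_⟩, ?_⟩
  · intro T P Q h
    have mem : ∀ P, F P ∈ L (P.vertex T) := by
      intro P
      have h1 : L (P.vertex T) = 𝒴.next (vertex M' σ δ P.1 T) (L P.point) := hstep P.point _ _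
      rw [h1]
      refine ⟨F P, hF P, ?_, (𝒴.equiv _).refl _⟩
      rw [hFp]
      rfl
    have hQ := mem Q
    rw [← h] at hQ
    exact (hL (P.vertex T)).rel (mem P) hQ
  · exact (𝒴.inj (hF (CoverChamber.origin M' σ δ base))
      (h₀.trans (hFp (CoverChamber.origin M' σ δ base)).symm)).symm

/-- The value y₀ is carried back to the origin through shared vertices; injectivity on residues
shows that the lift from there returns to y₀. -/
theorem exists_isLift {P₀ : CoverChamber M' σ δ base} {y₀ : Y} (h₀ : 𝒴.proj y₀ = P₀.1) :
    ∃ F : CoverChamber M' σ δ base → Y, 𝒴.IsLift F ∧ F P₀ = y₀ := by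
  induction P₀.reachable generalizing y₀ with
  | refl => exact exists_isLift_origin h₀
  | @tail P Q _ h ih =>
    obtain ⟨T, hT⟩ := h
    obtain ⟨y, hy, hyp⟩ := 𝒴.lift (T := T) (y := y₀) (D := P.1)
      (by rw [h₀]; exact (congrArg Sigma.fst hT).symm)
    obtain ⟨F, hF, hFP⟩ := ih hyp
    refine ⟨F, hF, ?_⟩
    refine (𝒴.inj (T := T) ?_ ?_).symm
    · refine (𝒴.equiv T).trans hy ?_
      rw [← hFP]
      exact hF.rel hT
    · rw [hF.proj, h₀]

theorem IsLift.eq {F G : CoverChamber M' σ δ base → Y} (hF : 𝒴.IsLift F) (hG : 𝒴.IsLift G)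
    {P₀ : CoverChamber M' σ δ base} (h₀ : F P₀ = G P₀) : F = G := by
  have step : ∀ {T P Q}, P.vertex T = Q.vertex T → F P = G P → F Q = G Q := by
    intro T P Q h hP
    refine 𝒴.inj (T := T) ((𝒴.equiv T).trans ((𝒴.equiv T).symm (hF.rel h)) ?_)
      ((hF.proj Q).trans (hG.proj Q).symm)
    rw [hP]
    exact hG.rel h
  have h1 : F (CoverChamber.origin M' σ δ base) = G (CoverChamber.origin M' σ δ base) := by
    have h1 := P₀.reachable
    generalize CoverChamber.origin M' σ δ base = O at h1 ⊢
    induction h1 using Relation.ReflTransGen.head_induction_on with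
    | refl => exact h₀
    | head h _ ih =>
      obtain ⟨T, hT⟩ := h
      exact step hT.symm ih
  funext P
  induction P.reachable with
  | refl => exact h1
  | tail _ h ih =>
    obtain ⟨T, hT⟩ := h
    exact step hT ih

end Covering

end

end Realization

/-! ### Right-angled chamber systems -/

/-- Two chambers lie in the same wall of type `i` if they are joined by a gallery with types in the
star of `i`. -/
def SameWall {I 𝒳 : Type*} (Γ : SimpleGraph I) (adj : I → 𝒳 → 𝒳 → Prop) (i : I) :
    𝒳 → 𝒳 → Prop :=
  Relation.ReflTransGen fun P Q => ∃ j, (j = i ∨ Γ.Adj i j) ∧ adj j P Q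

/-- A connected chamber system over the vertices of a graph `Γ`, with coordinates that identify
every `i`-residue with `X i`, whose residues of types joined by an edge form products, and
whose walls separate. -/
structure RightAngledSystem {I : Type*} (Γ : SimpleGraph I) (𝒳 : Type*) (X : I → Type*) where
  adj : I → 𝒳 → 𝒳 → Prop
  adj_equiv : ∀ i, Equivalence (adj i)
  coord : ∀ i, 𝒳 → X i
  coord_eq : ∀ {i j P Q}, i ≠ j → adj j P Q → coord i P = coord i Q
  exists_move : ∀ i P x, ∃ Q, adj i P Q ∧ coord i Q = x
  eq_of_coord : ∀ {i P Q}, adj i P Q → coord i P = coord i Q → P = Q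
  square : ∀ {i j P Q R}, Γ.Adj i j → adj i P Q → adj j P R → ∃ U, adj j Q U ∧ adj i R U
  connected : ∀ P Q, Relation.ReflTransGen (fun P Q => ∃ i, adj i P Q) P Q
  exists_sector : ∀ i K, ∃ sec : 𝒳 → X i, (∀ P, SameWall Γ adj i K P → sec P = coord i P) ∧
    ∀ j P Q, adj j P Q → (j ≠ i ∨ ¬ SameWall Γ adj i K P) → sec P = sec Q

namespace RightAngledSystem

variable {I : Type*} {Γ : SimpleGraph I} {𝒳 : Type*} {X : I → Type*}
  (𝒮 : RightAngledSystem Γ 𝒳 X) {i j k : I} {P Q R O : 𝒳}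

theorem refl (i : I) (P : 𝒳) : 𝒮.adj i P P := (𝒮.adj_equiv i).refl P

variable {𝒮} in
theorem symm (h : 𝒮.adj i P Q) : 𝒮.adj i Q P := (𝒮.adj_equiv i).symm h

variable {𝒮} in
theorem trans (h : 𝒮.adj i P Q) (h' : 𝒮.adj i Q R) : 𝒮.adj i P R := (𝒮.adj_equiv i).trans h h'

/-! #### Moves inside residues -/

/-- The chamber of the `i`-residue of `P` with `i`-coordinate `x`. -/
noncomputable def move (i : I) (P : 𝒳) (x : X i) : 𝒳 := (𝒮.exists_move i P x).choose

theorem adj_move (i : I) (P : 𝒳) (x : X i) : 𝒮.adj i P (𝒮.move i P x) :=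
  (𝒮.exists_move i P x).choose_spec.1

@[simp]
theorem coord_move (i : I) (P : 𝒳) (x : X i) : 𝒮.coord i (𝒮.move i P x) = x :=
  (𝒮.exists_move i P x).choose_spec.2

variable {𝒮} in
theorem eq_move (h : 𝒮.adj i P Q) : Q = 𝒮.move i P (𝒮.coord i Q) :=
  𝒮.eq_of_coord (trans (symm h) (𝒮.adj_move _ _ _)) (by simp)

variable {𝒮} in
theorem move_congr (h : 𝒮.adj i P Q) (x : X i) : 𝒮.move i P x = 𝒮.move i Q x :=
  𝒮.eq_of_coord (trans (symm (𝒮.adj_move _ _ _)) (trans h (𝒮.adj_move _ _ _))) (by simp)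

@[simp]
theorem move_coord (i : I) (P : 𝒳) : 𝒮.move i P (𝒮.coord i P) = P := (eq_move (𝒮.refl i P)).symm

theorem coord_move_of_ne (h : i ≠ j) (P : 𝒳) (x : X j) :
    𝒮.coord i (𝒮.move j P x) = 𝒮.coord i P := (𝒮.coord_eq h (𝒮.adj_move j P x)).symm

variable {𝒮} in
theorem adj_move_move (hij : Γ.Adj i j) (h : 𝒮.adj j P Q) (x : X i) :
    𝒮.adj j (𝒮.move i P x) (𝒮.move i Q x) := by
  obtain ⟨U, h1, h2⟩ := 𝒮.square hij (𝒮.adj_move i P x) h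
  have : U = 𝒮.move i Q x := by
    rw [eq_move h2, ← 𝒮.coord_eq hij.ne h1, coord_move]
  exact this ▸ h1

theorem move_comm (hij : Γ.Adj i j) (P : 𝒳) (x : X i) (y : X j) :
    𝒮.move j (𝒮.move i P x) y = 𝒮.move i (𝒮.move j P y) x := by
  have h := adj_move_move hij (𝒮.adj_move j P y) x
  rw [eq_move h, 𝒮.coord_move_of_ne hij.ne.symm, coord_move]

/-! #### Walls and sectors -/

variable {𝒮} in
theorem SameWall.symm (h : SameWall Γ 𝒮.adj i P Q) : SameWall Γ 𝒮.adj i Q P := by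
  induction h with
  | refl => exact Relation.ReflTransGen.refl
  | tail _ h ih =>
    obtain ⟨j, hj, hPQ⟩ := h
    exact Relation.ReflTransGen.head ⟨j, hj, RightAngledSystem.symm hPQ⟩ ih

variable {𝒮} in
theorem SameWall.of_adj (hj : j = i ∨ Γ.Adj i j) (h : 𝒮.adj j P Q) : SameWall Γ 𝒮.adj i P Q :=
  Relation.ReflTransGen.single ⟨j, hj, h⟩

/-- The equivalence relation of lying in the same wall of type `i`. -/
def wallSetoid (i : I) : Setoid 𝒳 where
  r := SameWall Γ 𝒮.adj i
  iseqv := ⟨fun _ => Relation.ReflTransGen.refl, SameWall.symm, Relation.ReflTransGen.trans⟩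

/-- The walls of type `i`. -/
abbrev Wall (i : I) : Type _ := Quotient (𝒮.wallSetoid i)

/-- The wall of type `i` that contains `P`. -/
def wall (i : I) (P : 𝒳) : 𝒮.Wall i := Quotient.mk (𝒮.wallSetoid i) P

theorem wall_eq : 𝒮.wall i P = 𝒮.wall i Q ↔ SameWall Γ 𝒮.adj i P Q :=
  Quotient.eq (r := 𝒮.wallSetoid i)

variable {𝒮} in
theorem wall_eq_of_adj (hj : j = i ∨ Γ.Adj i j) (h : 𝒮.adj j P Q) : 𝒮.wall i P = 𝒮.wall i Q :=
  𝒮.wall_eq.mpr (SameWall.of_adj hj h)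

theorem exists_sector_wall (i : I) (κ : 𝒮.Wall i) : ∃ sec : 𝒳 → X i,
    (∀ P, 𝒮.wall i P = κ → sec P = 𝒮.coord i P) ∧
      ∀ j P Q, 𝒮.adj j P Q → (j ≠ i ∨ 𝒮.wall i P ≠ κ) → sec P = sec Q := by
  induction κ using Quotient.inductionOn with
  | h K =>
    obtain ⟨sec, h1, h2⟩ := 𝒮.exists_sector i K
    refine ⟨sec, fun P hP => h1 P (SameWall.symm (𝒮.wall_eq.mp hP)), fun j P Q h h' => h2 j P Q h ?_⟩
    exact h'.imp_right fun h3 h4 => h3 (𝒮.wall_eq.mpr (SameWall.symm h4))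

/-- The sector of the wall `κ` that contains a chamber. -/
noncomputable def sector {i : I} (κ : 𝒮.Wall i) : 𝒳 → X i := (𝒮.exists_sector_wall i κ).choose

theorem sector_wall (i : I) (P : 𝒳) : 𝒮.sector (𝒮.wall i P) P = 𝒮.coord i P :=
  (𝒮.exists_sector_wall i _).choose_spec.1 P rfl

variable {𝒮} in
theorem sector_of_wall_eq {κ : 𝒮.Wall i} (h : 𝒮.wall i P = κ) : 𝒮.sector κ P = 𝒮.coord i P :=
  h ▸ 𝒮.sector_wall i P

variable {𝒮} in
theorem sector_eq {κ : 𝒮.Wall i} (h : 𝒮.adj j P Q) (h' : j ≠ i ∨ 𝒮.wall i P ≠ κ) :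
    𝒮.sector κ P = 𝒮.sector κ Q :=
  (𝒮.exists_sector_wall i κ).choose_spec.2 j P Q h h'

/-! #### Descents -/

/-- The chamber of the `i`-residue of `P` that is closest to `O`. -/
noncomputable def low (O : 𝒳) (i : I) (P : 𝒳) : 𝒳 :=
  𝒮.move i P (𝒮.sector (𝒮.wall i P) O)

/-- `P` is not the chamber of its `i`-residue that is closest to `O`. -/
def Descent (O : 𝒳) (i : I) (P : 𝒳) : Prop := 𝒮.coord i P ≠ 𝒮.sector (𝒮.wall i P) O

theorem adj_low (O : 𝒳) (i : I) (P : 𝒳) : 𝒮.adj i P (𝒮.low O i P) := 𝒮.adj_move _ _ _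

theorem coord_low (O : 𝒳) (i : I) (P : 𝒳) :
    𝒮.coord i (𝒮.low O i P) = 𝒮.sector (𝒮.wall i P) O := 𝒮.coord_move _ _ _

variable {𝒮} in
theorem low_congr (h : 𝒮.adj i P Q) : 𝒮.low O i P = 𝒮.low O i Q := by
  rw [low, low, wall_eq_of_adj (Or.inl rfl) h, move_congr h]

theorem not_descent_iff : ¬ 𝒮.Descent O i P ↔ 𝒮.low O i P = P := by
  rw [Descent, not_not]
  constructor
  · intro h
    rw [low, ← h, move_coord]
  · intro h
    rw [← 𝒮.coord_low O i P, h]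

theorem not_descent_low (O : 𝒳) (i : I) (P : 𝒳) : ¬ 𝒮.Descent O i (𝒮.low O i P) := by
  rw [not_descent_iff, ← low_congr (𝒮.adj_low O i P)]

theorem not_descent_self (O : 𝒳) (i : I) : ¬ 𝒮.Descent O i O := by
  rw [Descent, not_not, sector_wall]

variable {𝒮} in
theorem descent_of_ne_low (h : 𝒮.adj i P Q) (h' : P ≠ Q) (hP : ¬ 𝒮.Descent O i P) :
    𝒮.Descent O i Q := by
  by_contra hQ
  rw [not_descent_iff] at hP hQ
  exact h' (by rw [← hP, ← hQ, low_congr h])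

variable {𝒮} in
theorem descent_iff_of_adj (hij : Γ.Adj i j) (h : 𝒮.adj j P Q) :
    𝒮.Descent O i P ↔ 𝒮.Descent O i Q := by
  rw [Descent, Descent, wall_eq_of_adj (Or.inr hij) h, 𝒮.coord_eq hij.ne h]

/-- Two different descents have types joined by an edge. -/
theorem adj_of_descent (hjk : j ≠ k) (hj : 𝒮.Descent O j Q) (hk : 𝒮.Descent O k Q) :
    Γ.Adj j k := by
  by_contra hadj
  -- The k-wall of Q is joined to Q without steps of type j, so it lies in the sector of Q with
  -- respect to the j-wall.
  have aux : ∀ {j k : I}, j ≠ k → ¬ Γ.Adj j k → ∀ P, 𝒮.wall k P = 𝒮.wall k Q →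
      𝒮.sector (𝒮.wall j Q) P = 𝒮.coord j Q := by
    intro j k hjk hadj P hP
    have hw : SameWall Γ 𝒮.adj k Q P := 𝒮.wall_eq.mp hP.symm
    clear hP
    induction hw with
    | refl => exact 𝒮.sector_wall j Q
    | tail _ h ih =>
      obtain ⟨l, hl, hPQ⟩ := h
      rw [← ih]
      refine (sector_eq hPQ (Or.inl ?_)).symm
      rintro rfl
      rcases hl with hl | hl
      · exact hjk hl
      · exact hadj hl.symm
  -- No chamber leaves both sectors of Q: changing the sector of one wall is possible only inside
  -- that wall, which lies in the sector of Q for the other.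
  have key : ∀ P, 𝒮.sector (𝒮.wall j Q) P = 𝒮.coord j Q ∨
      𝒮.sector (𝒮.wall k Q) P = 𝒮.coord k Q := by
    intro P
    induction 𝒮.connected Q P with
    | refl => exact Or.inl (𝒮.sector_wall j Q)
    | @tail P R _ h _ =>
      obtain ⟨l, hPR⟩ := h
      by_cases hwj : 𝒮.wall j R = 𝒮.wall j Q
      · exact Or.inr (aux hjk.symm (fun h => hadj h.symm) R hwj)
      by_cases hwk : 𝒮.wall k R = 𝒮.wall k Q
      · exact Or.inl (aux hjk hadj R hwk)
      rename_i ih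
      rwa [← sector_eq (symm hPR) (Or.inr hwj), ← sector_eq (symm hPR) (Or.inr hwk)] at ih
  rcases key O with h | h
  · exact hj h.symm
  · exact hk h.symm

theorem low_low (hij : Γ.Adj i j) (O P : 𝒳) :
    𝒮.low O i (𝒮.low O j P) = 𝒮.low O j (𝒮.low O i P) := by
  have h1 : 𝒮.wall i (𝒮.low O j P) = 𝒮.wall i P :=
    (wall_eq_of_adj (Or.inr hij) (𝒮.adj_low O j P)).symm
  have h2 : 𝒮.wall j (𝒮.low O i P) = 𝒮.wall j P :=
    (wall_eq_of_adj (Or.inr hij.symm) (𝒮.adj_low O i P)).symm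
  rw [low, h1, low, low, h2, low, move_comm _ hij]

variable {𝒮} in
theorem descent_low (hij : Γ.Adj i j) : 𝒮.Descent O i (𝒮.low O j P) ↔ 𝒮.Descent O i P :=
  (descent_iff_of_adj hij (𝒮.adj_low O j P)).symm

/-! #### Chambers are joined to `O` by descending galleries -/

/-- `P` is joined to `O` by a descending gallery. -/
inductive Descends (O : 𝒳) : 𝒳 → Prop
  | base : Descends O O
  | step (k : I) (P : 𝒳) (h : 𝒮.Descent O k P) (h' : Descends O (𝒮.low O k P)) : Descends O P

variable {𝒮} in
-- A descending gallery that starts with another type j is pushed across the squares spanned by j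
-- and k.
theorem Descends.low (h : 𝒮.Descends O Q) (hk : 𝒮.Descent O k Q) :
    𝒮.Descends O (𝒮.low O k Q) := by
  induction h generalizing k with
  | base => exact absurd hk (𝒮.not_descent_self O k)
  | step j Q hj h' ih =>
    by_cases hjk : j = k
    · exact hjk ▸ h'
    · have hadj := 𝒮.adj_of_descent hjk hj hk
      refine Descends.step j _ ((descent_low hadj).mpr hj) ?_
      rw [𝒮.low_low hadj]
      exact ih ((descent_low hadj.symm).mpr hk)

theorem descends (O P : 𝒳) : 𝒮.Descends O P := by
  induction 𝒮.connected O P with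
  | refl => exact Descends.base
  | @tail Q P _ h ih =>
    obtain ⟨k, hk⟩ := h
    have hlow : 𝒮.Descends O (𝒮.low O k Q) := by
      by_cases hd : 𝒮.Descent O k Q
      · exact ih.low hd
      · rwa [𝒮.not_descent_iff.mp hd]
    rw [low_congr hk] at hlow
    by_cases hd : 𝒮.Descent O k P
    · exact Descends.step k P hd hlow
    · rwa [𝒮.not_descent_iff.mp hd] at hlow

theorem exists_descent (h : P ≠ O) : ∃ k, 𝒮.Descent O k P := by
  cases 𝒮.descends O P with
  | base => exact absurd rfl h
  | step k _ hk _ => exact ⟨k, hk⟩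

/-! #### The length -/

/-- The walls that separate `P` from `O`. -/
def separating (O P : 𝒳) : Set (Σ i, 𝒮.Wall i) := {κ | 𝒮.sector κ.2 O ≠ 𝒮.sector κ.2 P}

/-- The number of walls that separate `P` from `O`. -/
noncomputable def length (O P : 𝒳) : ℕ := (𝒮.separating O P).ncard

/-- The step to the closest chamber crosses only the i-wall of P, and enters the sector of that wall
that contains O. -/
theorem separating_of_descent (h : 𝒮.Descent O i P) :
    𝒮.separating O P = insert ⟨i, 𝒮.wall i P⟩ (𝒮.separating O (𝒮.low O i P)) ∧
      (⟨i, 𝒮.wall i P⟩ : Σ i, 𝒮.Wall i) ∉ 𝒮.separating O (𝒮.low O i P) := by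
  constructor
  · ext ⟨j, κ⟩
    by_cases hκ : (⟨j, κ⟩ : Σ i, 𝒮.Wall i) = ⟨i, 𝒮.wall i P⟩
    · rw [hκ]
      simp only [Set.mem_insert_iff, true_or, iff_true]
      change 𝒮.sector (𝒮.wall i P) O ≠ 𝒮.sector (𝒮.wall i P) P
      rw [sector_wall]
      exact h.symm
    · simp only [Set.mem_insert_iff, hκ, false_or]
      change 𝒮.sector κ O ≠ 𝒮.sector κ P ↔ 𝒮.sector κ O ≠ 𝒮.sector κ (𝒮.low O i P)
      rw [sector_eq (𝒮.adj_low O i P)]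
      by_cases hij : i = j
      · subst hij
        refine Or.inr fun h1 => hκ ?_
        rw [h1]
      · exact Or.inl hij
  · simp only [separating, Set.mem_ofPred_eq, not_not]
    rw [sector_of_wall_eq (wall_eq_of_adj (Or.inl rfl) (𝒮.adj_low O i P)).symm, coord_low]

theorem finite_separating (O P : 𝒳) : (𝒮.separating O P).Finite := by
  induction 𝒮.descends O P with
  | base => simp [separating]
  | step k P h _ ih =>
    rw [(𝒮.separating_of_descent h).1]
    exact ih.insert _

@[simp]
theorem length_self (O : 𝒳) : 𝒮.length O O = 0 := by simp [length, separating]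

variable {𝒮} in
theorem length_of_descent (h : 𝒮.Descent O i P) :
    𝒮.length O P = 𝒮.length O (𝒮.low O i P) + 1 := by
  rw [length, (𝒮.separating_of_descent h).1,
    Set.ncard_insert_of_notMem (𝒮.separating_of_descent h).2 (𝒮.finite_separating _ _), length]

variable {𝒮} in
theorem length_le_of_adj (h : 𝒮.adj i P Q) : 𝒮.length O Q ≤ 𝒮.length O P + 1 := by
  have hlow : 𝒮.length O (𝒮.low O i P) ≤ 𝒮.length O P := by
    by_cases hP : 𝒮.Descent O i P
    · rw [length_of_descent hP]
      exact Nat.le_succ _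
    · rw [𝒮.not_descent_iff.mp hP]
  by_cases hQ : 𝒮.Descent O i Q
  · rw [length_of_descent hQ, ← low_congr h]
    exact Nat.succ_le_succ hlow
  · rw [← 𝒮.not_descent_iff.mp hQ, ← low_congr h]
    exact hlow.trans (Nat.le_succ _)

theorem eq_of_length_eq_zero (h : 𝒮.length O P = 0) : P = O := by
  by_contra hne
  obtain ⟨k, hk⟩ := 𝒮.exists_descent hne
  rw [length_of_descent hk] at h
  exact Nat.succ_ne_zero _ h

variable {𝒮} in
/-- A residue with two chambers of length less than `n` is contained in the ball of radius `n`. -/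
theorem length_lt_of_adj {n : ℕ} (h : 𝒮.adj i P Q) (hne : P ≠ Q) (hP : 𝒮.length O P < n)
    (hQ : 𝒮.length O Q < n) (h' : 𝒮.adj i P R) : 𝒮.length O R < n := by
  -- One of two distinct chambers of a residue is a descent, so the closest chamber is shorter by
  -- one; all others exceed it by at most one.
  have hlow : 𝒮.length O (𝒮.low O i P) + 1 < n := by
    by_cases hd : 𝒮.Descent O i P
    · rwa [← length_of_descent hd]
    · have hd' := descent_of_ne_low h hne hd
      rwa [low_congr h, ← length_of_descent hd']
  have := length_le_of_adj (O := O) (trans (symm (𝒮.adj_low O i P)) h')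
  exact this.trans_lt hlow

/-- The length is the gallery distance. -/
theorem length_lt_iff {n : ℕ} : 𝒮.length O P < n ↔ ∃ k < n, ∃ c : ℕ → 𝒳, c 0 = O ∧ c k = P ∧
    ∀ m < k, ∃ i : I, 𝒮.adj i (c m) (c (m + 1)) := by
  constructor
  · intro h
    refine ⟨_, h, ?_⟩
    clear h
    induction 𝒮.descends O P with
    | base => exact ⟨fun _ => O, rfl, rfl, by simp⟩
    | step k P h _ ih =>
      obtain ⟨c, h0, hk, hc⟩ := ih
      refine ⟨fun m => if m ≤ 𝒮.length O (𝒮.low O k P) then c m else P, by simp [h0], ?_, ?_⟩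
      · simp [length_of_descent h]
      · intro m hm
        rw [length_of_descent h] at hm
        rcases (Nat.lt_succ_iff_lt_or_eq.mp hm) with hm | hm
        · obtain ⟨i, hi⟩ := hc m hm
          refine ⟨i, ?_⟩
          beta_reduce
          rw [if_pos hm.le, if_pos (Nat.succ_le_of_lt hm)]
          exact hi
        · refine ⟨k, ?_⟩
          beta_reduce
          rw [if_pos hm.le, if_neg (by omega), hm, hk]
          exact symm (𝒮.adj_low O k P)
  · rintro ⟨k, hk, c, rfl, rfl, hc⟩
    have : ∀ m ≤ k, 𝒮.length (c 0) (c m) ≤ m := by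
      intro m
      induction m with
      | zero => simp
      | succ m ih =>
        intro hm
        obtain ⟨i, hi⟩ := hc m hm
        exact (length_le_of_adj hi).trans (Nat.succ_le_succ (ih (Nat.le_of_succ_le hm)))
    exact (this k le_rfl).trans_lt hk

/-! #### Maps that are bijective on residues -/

/-- A self-map that is bijective on residues is bijective. -/
theorem bijective_of_move {f : 𝒳 → 𝒳} {a : ∀ i, 𝒳 → X i → X i} (ha : ∀ i P, (a i P).Bijective)
    (hf : ∀ i P x, f (𝒮.move i P x) = 𝒮.move i (f P) (a i P x)) : f.Bijective := by
  have hadj : ∀ {i P Q}, 𝒮.adj i P Q → 𝒮.adj i (f P) (f Q) := by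
    intro i P Q h
    rw [eq_move h, hf]
    exact 𝒮.adj_move _ _ _
  have hinj : ∀ {i P Q}, 𝒮.adj i P Q → f P = f Q → P = Q := by
    intro i P Q h h'
    rw [← 𝒮.move_coord i P, eq_move h, hf, hf] at h'
    have := congrArg (𝒮.coord i) h'
    rw [coord_move, coord_move] at this
    rw [eq_move h, ← (ha i P).1 this, move_coord]
  constructor
  · intro O Q hOQ
    -- Descents towards O correspond to descents towards f O. A chamber Q ≠ O has a descent, whereas
    -- f Q = f O would have none.
    have key : ∀ m Q, 𝒮.length O Q = m → ∀ j, 𝒮.Descent (f O) j (f Q) ↔ 𝒮.Descent O j Q := by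
      intro m
      induction m with
      | zero =>
        intro Q hQ j
        rw [𝒮.eq_of_length_eq_zero hQ]
        exact iff_of_false (𝒮.not_descent_self _ _) (𝒮.not_descent_self _ _)
      | succ m ih =>
        intro Q hQ j
        have up : ∀ {j}, 𝒮.Descent O j Q → 𝒮.Descent (f O) j (f Q) := by
          intro j hj
          have hl : 𝒮.length O (𝒮.low O j Q) = m := by
            have := length_of_descent hj
            omega
          refine descent_of_ne_low (hadj (symm (𝒮.adj_low O j Q))) ?_
            (fun h => 𝒮.not_descent_low O j Q ((ih _ hl j).mp h))
          intro h
          have h1 := hinj (symm (𝒮.adj_low O j Q)) h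
          exact 𝒮.not_descent_iff.mpr h1 hj
        refine ⟨fun hj => ?_, up⟩
        have hne : Q ≠ O := by
          rintro rfl
          rw [length_self] at hQ
          exact Nat.succ_ne_zero _ hQ.symm
        obtain ⟨k, hk⟩ := 𝒮.exists_descent hne
        by_cases hjk : j = k
        · exact hjk ▸ hk
        -- Since j and k are joined by an edge, the descent j persists on passing to the shorter
        -- chamber `low O k Q`, where the induction hypothesis applies.
        have hjk' := 𝒮.adj_of_descent hjk hj (up hk)
        have hl : 𝒮.length O (𝒮.low O k Q) = m := by
          have := length_of_descent hk
          omega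
        rw [descent_iff_of_adj hjk' (hadj (𝒮.adj_low O k Q)), ih _ hl] at hj
        exact (descent_low hjk').mp hj
    by_contra hne
    obtain ⟨k, hk⟩ := 𝒮.exists_descent (fun h => hne h.symm : Q ≠ O)
    rw [← key _ Q rfl, ← hOQ] at hk
    exact 𝒮.not_descent_self _ _ hk
  · intro R
    obtain ⟨O⟩ : Nonempty 𝒳 := ⟨R⟩
    induction 𝒮.connected (f O) R with
    | refl => exact ⟨O, rfl⟩
    | tail _ h ih =>
      obtain ⟨P, rfl⟩ := ih
      obtain ⟨i, hi⟩ := h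
      obtain ⟨x, hx⟩ := (ha i P).2 (𝒮.coord i _)
      exact ⟨𝒮.move i P x, by rw [hf, hx, ← eq_move hi]⟩

end RightAngledSystem

/-! ### Extending automorphisms of balls -/

namespace RightAngledSystem

variable {I : Type*} {Γ : SimpleGraph I} {𝒳 : Type*} {X S : I → Type*}
  (𝒮 : RightAngledSystem Γ 𝒳 X) (r : ∀ i, S i → X i → X i → Prop) {i j k : I} {P Q R O : 𝒳}
  {n : ℕ} {G : 𝒳 → 𝒳}

/-- The `s`-equivalence on chambers that is induced by relations on the coordinates. -/
def Equivalent (s : Σ i, S i) (P Q : 𝒳) : Prop :=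
  𝒮.adj s.1 P Q ∧ r s.1 s.2 (𝒮.coord s.1 P) (𝒮.coord s.1 Q)

/-- The map `G` restricts to an automorphism of the ball of radius `n` around `O`. -/
structure IsBallAut (O : 𝒳) (n : ℕ) (G : 𝒳 → 𝒳) : Prop where
  mapsTo : ∀ {P}, 𝒮.length O P < n → 𝒮.length O (G P) < n
  inj : ∀ {P Q}, 𝒮.length O P < n → 𝒮.length O Q < n → G P = G Q → P = Q
  surj : ∀ {Q}, 𝒮.length O Q < n → ∃ P, 𝒮.length O P < n ∧ G P = Q
  equivalent : ∀ {s P Q}, 𝒮.length O P < n → 𝒮.length O Q < n →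
    (𝒮.Equivalent r s P Q ↔ 𝒮.Equivalent r s (G P) (G Q))

variable {𝒮 r}

/-- By `hr` an adjacency is a chain of equivalences inside one residue. A residue with two chambers
in the ball lies in the ball, so G can be applied to the chain, or the chain pulled back through G.
-/
theorem IsBallAut.adj_iff
    (hr : ∀ {i P Q}, 𝒮.adj i P Q →
      Relation.ReflTransGen (fun P Q => ∃ s : Σ i, S i, s.1 = i ∧ 𝒮.Equivalent r s P Q) P Q)
    (hG : 𝒮.IsBallAut r O n G) (hP : 𝒮.length O P < n) (hQ : 𝒮.length O Q < n) :
    𝒮.adj i P Q ↔ 𝒮.adj i (G P) (G Q) := by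
  constructor
  · intro h
    by_cases hne : P = Q
    · rw [hne]
      exact 𝒮.refl _ _
    have key : ∀ R, Relation.ReflTransGen
        (fun P Q => ∃ s : Σ i, S i, s.1 = i ∧ 𝒮.Equivalent r s P Q) P R →
        𝒮.adj i P R ∧ 𝒮.adj i (G P) (G R) := by
      intro R hR
      induction hR with
      | refl => exact ⟨𝒮.refl _ _, 𝒮.refl _ _⟩
      | @tail R R' _ hs ih =>
        obtain ⟨s, rfl, hs⟩ := hs
        have h1 := trans ih.1 hs.1
        exact ⟨h1, trans ih.2 ((hG.equivalent (length_lt_of_adj h hne hP hQ ih.1)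
          (length_lt_of_adj h hne hP hQ h1)).mp hs).1⟩
    exact (key Q (hr h)).2
  · intro h
    by_cases hne : P = Q
    · rw [hne]
      exact 𝒮.refl _ _
    have hne' : G P ≠ G Q := fun h => hne (hG.inj hP hQ h)
    have key : ∀ R, Relation.ReflTransGen
        (fun P Q => ∃ s : Σ i, S i, s.1 = i ∧ 𝒮.Equivalent r s P Q) (G P) R →
        𝒮.adj i (G P) R ∧ ∃ R', 𝒮.length O R' < n ∧ G R' = R ∧ 𝒮.adj i P R' := by
      intro R hR
      induction hR with
      | refl => exact ⟨𝒮.refl _ _, P, hP, rfl, 𝒮.refl _ _⟩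
      | @tail R U _ hs ih =>
        obtain ⟨s, rfl, hs⟩ := hs
        obtain ⟨h1, R', hR', rfl, h2⟩ := ih
        have h3 := trans h1 hs.1
        obtain ⟨U', hU', rfl⟩ :=
          hG.surj (length_lt_of_adj h hne' (hG.mapsTo hP) (hG.mapsTo hQ) h3)
        exact ⟨h3, U', hU', rfl, trans h2 ((hG.equivalent hR' hU').mpr hs).1⟩
    obtain ⟨-, Q', hQ', hQQ, h1⟩ := key _ (hr h)
    rwa [← hG.inj hQ' hQ hQQ]

theorem length_move_lt (hP : 𝒮.length O P + 1 < n) (x : X i) :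
    𝒮.length O (𝒮.move i P x) < n :=
  (length_le_of_adj (𝒮.adj_move i P x)).trans_lt hP

/-- One layer below the boundary the whole i-residue of P lies in the ball, so G carries it onto the
i-residue of G P; read in coordinates this is a permutation of X i. -/
theorem IsBallAut.exists_perm
    (hr : ∀ {i P Q}, 𝒮.adj i P Q →
      Relation.ReflTransGen (fun P Q => ∃ s : Σ i, S i, s.1 = i ∧ 𝒮.Equivalent r s P Q) P Q)
    (hG : 𝒮.IsBallAut r O n G) (i : I) (hP : 𝒮.length O P + 1 < n) :
    ∃ a : Equiv.Perm (X i), (∀ x, 𝒮.coord i (G (𝒮.move i P x)) = a x) ∧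
      ∀ s x y, r i s x y ↔ r i s (a x) (a y) := by
  have hP' : 𝒮.length O P < n := (Nat.lt_succ_self _).trans hP
  have hadj : ∀ x y : X i, 𝒮.adj i (G (𝒮.move i P x)) (G (𝒮.move i P y)) := fun x y =>
    (hG.adj_iff hr (length_move_lt hP x) (length_move_lt hP y)).mp
      (trans (symm (𝒮.adj_move _ _ _)) (𝒮.adj_move _ _ _))
  have hinj : Function.Injective fun x => 𝒮.coord i (G (𝒮.move i P x)) := by
    intro x y h
    have := hG.inj (length_move_lt hP x) (length_move_lt hP y) (𝒮.eq_of_coord (hadj x y) h)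
    rw [← 𝒮.coord_move i P x, this, coord_move]
  have hsurj : Function.Surjective fun x => 𝒮.coord i (G (𝒮.move i P x)) := by
    intro y
    have hlt : 𝒮.length O (𝒮.move i (G P) y) < n := by
      -- If the residue of P has two chambers, their images force the residue of G P into the ball.
      -- Otherwise X i is a single point.
      by_cases hx : ∃ x, 𝒮.move i P x ≠ P
      · obtain ⟨x, hx⟩ := hx
        have h1 := hadj (𝒮.coord i P) x
        rw [move_coord] at h1
        exact length_lt_of_adj h1 (fun h => hx (hG.inj hP' (length_move_lt hP x) h).symm)
          (hG.mapsTo hP') (hG.mapsTo (length_move_lt hP x)) (𝒮.adj_move _ _ _)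
      · have hy : y = 𝒮.coord i (G P) := by
          have h0 : ∀ x, x = 𝒮.coord i P := fun x => by
            rw [← 𝒮.coord_move i P x]
            exact congrArg _ (not_not.mp fun h => hx ⟨x, h⟩)
          rw [h0 y, ← h0 (𝒮.coord i (G P))]
        rw [hy, move_coord]
        exact hG.mapsTo hP'
    obtain ⟨Q, hQ, hQG⟩ := hG.surj hlt
    refine ⟨𝒮.coord i Q, ?_⟩
    have h1 : 𝒮.adj i P Q := (hG.adj_iff hr hP' hQ).mpr (by rw [hQG]; exact 𝒮.adj_move _ _ _)
    beta_reduce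
    rw [← eq_move h1, hQG, coord_move]
  refine ⟨Equiv.ofBijective _ ⟨hinj, hsurj⟩, fun _ => rfl, fun s x y => ?_⟩
  have h1 := hG.equivalent (s := ⟨i, s⟩) (length_move_lt hP x) (length_move_lt hP y)
  have h2 : 𝒮.adj i (𝒮.move i P x) (𝒮.move i P y) :=
    trans (symm (𝒮.adj_move _ _ _)) (𝒮.adj_move _ _ _)
  simp only [Equivalent, h2, hadj x y, true_and, coord_move] at h1
  exact h1

/-- The local permutations of an automorphism of a ball extend to all chambers, such that they
are constant along walls. -/
theorem IsBallAut.exists_portrait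
    (hr : ∀ {i P Q}, 𝒮.adj i P Q →
      Relation.ReflTransGen (fun P Q => ∃ s : Σ i, S i, s.1 = i ∧ 𝒮.Equivalent r s P Q) P Q)
    (hn : 2 ≤ n) (hG : 𝒮.IsBallAut r O n G) :
    ∃ a : ∀ i, 𝒳 → Equiv.Perm (X i),
      (∀ i P, 𝒮.length O P + 1 < n → ∀ x, 𝒮.coord i (G (𝒮.move i P x)) = a i P x) ∧
      (∀ i P s x y, r i s x y ↔ r i s (a i P x) (a i P y)) ∧
      (∀ i k P, (k = i ∨ Γ.Adj i k) → 𝒮.Descent O k P → a i P = a i (𝒮.low O k P)) ∧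
      ∀ i P, n ≤ 𝒮.length O P + 1 → ∃ k, 𝒮.Descent O k P ∧ a i P = a i (𝒮.low O k P) := by
  have hex : ∀ i P, ∃ a : Equiv.Perm (X i), (𝒮.length O P + 1 < n →
      ∀ x, 𝒮.coord i (G (𝒮.move i P x)) = a x) ∧ ∀ s x y, r i s x y ↔ r i s (a x) (a y) := by
    intro i P
    by_cases hP : 𝒮.length O P + 1 < n
    · obtain ⟨a, h1, h2⟩ := hG.exists_perm hr i hP
      exact ⟨a, fun _ => h1, h2⟩
    · exact ⟨1, fun h => absurd h hP, fun _ _ _ => Iff.rfl⟩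
  choose b hb hbr using hex
  -- The descent used for inheritance is taken in the star of i whenever possible. This preference
  -- is what makes the permutations constant along i-walls.
  have hparent : ∀ i P, ∃ k, P ≠ O → 𝒮.Descent O k P ∧
      ((∃ l, (l = i ∨ Γ.Adj i l) ∧ 𝒮.Descent O l P) → (k = i ∨ Γ.Adj i k)) := by
    intro i P
    by_cases hl : ∃ l, (l = i ∨ Γ.Adj i l) ∧ 𝒮.Descent O l P
    · obtain ⟨l, h1, h2⟩ := hl
      exact ⟨l, fun _ => ⟨h2, fun _ => h1⟩⟩
    · by_cases hP : P = O
      · exact ⟨i, fun h => absurd hP h⟩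
      · obtain ⟨k, hk⟩ := 𝒮.exists_descent hP
        exact ⟨k, fun _ => ⟨hk, fun h => absurd h hl⟩⟩
  choose p hp using hparent
  -- The number of steps leads down to length n - 2, where residues are still sure to lie in the
  -- ball; truncated subtraction gives no step for shorter chambers.
  let ρ : I → 𝒳 → 𝒳 := fun i P =>
    (fun Q => 𝒮.low O (p i Q) Q)^[𝒮.length O P + 2 - n] P
  have hρ0 : ∀ i P, 𝒮.length O P + 1 < n → ρ i P = P := by
    intro i P h
    have : 𝒮.length O P + 2 - n = 0 := by omega
    simp [ρ, this]
  have hne : ∀ {P}, n ≤ 𝒮.length O P + 1 → P ≠ O := by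
    rintro P h rfl
    rw [length_self] at h
    omega
  have hρ1 : ∀ i P, n ≤ 𝒮.length O P + 1 → ρ i P = ρ i (𝒮.low O (p i P) P) := by
    intro i P h
    have h1 := length_of_descent (hp i P (hne h)).1
    have h2 : 𝒮.length O P + 2 - n = (𝒮.length O (𝒮.low O (p i P) P) + 2 - n) + 1 := by omega
    simp only [ρ]
    rw [h2, Function.iterate_succ_apply]
  refine ⟨fun i P => b i (ρ i P), ?_, fun i P => hbr i _, ?_, ?_⟩
  · intro i P h
    beta_reduce
    rw [hρ0 i P h]
    exact hb i P h
  · have key : ∀ m i k P, 𝒮.length O P = m → (k = i ∨ Γ.Adj i k) → 𝒮.Descent O k P →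
        b i (ρ i P) = b i (ρ i (𝒮.low O k P)) := by
      intro m
      induction m with
      | zero =>
        intro i k P hm _ hd
        rw [length_of_descent hd] at hm
        exact absurd hm (Nat.succ_ne_zero _)
      | succ m ih =>
        intro i k P hm hk hd
        have hl := length_of_descent hd
        by_cases hlt : 𝒮.length O P + 1 < n
        · have hlt' : 𝒮.length O (𝒮.low O k P) + 1 < n := by omega
          rw [hρ0 i P hlt, hρ0 i _ hlt']
          ext x
          rw [← hb i _ hlt, ← hb i _ hlt']
          rcases hk with rfl | hk
          · rw [move_congr (𝒮.adj_low O k P)]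
          · exact 𝒮.coord_eq hk.ne ((hG.adj_iff hr (length_move_lt hlt x)
              (length_move_lt hlt' x)).mp (adj_move_move hk (𝒮.adj_low O k P) x))
        · have hP := hne (not_lt.mp hlt)
          obtain ⟨h1, h2⟩ := hp i P hP
          rw [hρ1 i P (not_lt.mp hlt)]
          by_cases hkp : k = p i P
          · rw [← hkp]
          -- The descents k and `p i P` both lie in the star of i and span a square, so induction
          -- along its two lower sides compares the values.
          have hadj := 𝒮.adj_of_descent hkp hd h1
          have hl' := length_of_descent h1
          rw [ih i k _ (by omega) hk ((descent_low hadj).mpr hd),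
            ih i (p i P) (𝒮.low O k P) (by omega) (h2 ⟨k, hk, hd⟩)
              ((descent_low hadj.symm).mpr h1), 𝒮.low_low hadj]
    exact fun i k P => key _ i k P rfl
  · intro i P h
    exact ⟨p i P, (hp i P (hne h)).1, congrArg (b i) (hρ1 i P h)⟩

/-- An automorphism of a ball of radius at least `2` extends. -/
theorem IsBallAut.exists_extension
    (hr : ∀ {i P Q}, 𝒮.adj i P Q →
      Relation.ReflTransGen (fun P Q => ∃ s : Σ i, S i, s.1 = i ∧ 𝒮.Equivalent r s P Q) P Q)
    (hn : 2 ≤ n) (hG : 𝒮.IsBallAut r O n G) :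
    ∃ f : Equiv.Perm 𝒳, (∀ s P Q, 𝒮.Equivalent r s P Q ↔ 𝒮.Equivalent r s (f P) (f Q)) ∧
      ∀ P, 𝒮.length O P < n → f P = G P := by
  obtain ⟨a, haG, har, hastar, hapar⟩ := hG.exists_portrait hr hn
  have hchoice : ∀ P, n ≤ 𝒮.length O P → ∃ k, 𝒮.Descent O k P := by
    refine fun P h => 𝒮.exists_descent ?_
    rintro rfl
    rw [length_self] at h
    omega
  choose q hq using hchoice
  -- Recursion on the number of layers outside the ball: length + 1 - n vanishes exactly on the ball
  -- and drops by one with each descent outside it.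
  let F : ℕ → 𝒳 → 𝒳 := fun m => Nat.rec G (fun _ F' P =>
    if h : n ≤ 𝒮.length O P then
      𝒮.move (q P h) (F' (𝒮.low O (q P h) P))
        (a (q P h) (𝒮.low O (q P h) P) (𝒮.coord (q P h) P))
    else G P) m
  let f : 𝒳 → 𝒳 := fun P => F (𝒮.length O P + 1 - n) P
  have hf0 : ∀ P, 𝒮.length O P < n → f P = G P := by
    intro P h
    have : 𝒮.length O P + 1 - n = 0 := by omega
    simp [f, F, this]
  have hf1 : ∀ P (h : n ≤ 𝒮.length O P), f P = 𝒮.move (q P h) (f (𝒮.low O (q P h) P))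
      (a (q P h) (𝒮.low O (q P h) P) (𝒮.coord (q P h) P)) := by
    intro P h
    have h1 := length_of_descent (hq P h)
    have h2 : 𝒮.length O P + 1 - n = (𝒮.length O (𝒮.low O (q P h) P) + 1 - n) + 1 := by omega
    simp only [f]
    rw [h2]
    simp only [F]
    rw [dif_pos h]
  -- Independence of the chosen descent and the action of f on all coordinates are proved together,
  -- each using the other for shorter chambers.
  have key : ∀ m P, 𝒮.length O P = m →
      (∀ j, 𝒮.Descent O j P →
        f P = 𝒮.move j (f (𝒮.low O j P)) (a j (𝒮.low O j P) (𝒮.coord j P))) ∧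
      ∀ j, 𝒮.coord j (f P) = a j P (𝒮.coord j P) := by
    intro m
    induction m using Nat.strong_induction_on with
    | _ m ih =>
      intro P hm
      have hdesc : ∀ j, 𝒮.Descent O j P →
          f P = 𝒮.move j (f (𝒮.low O j P)) (a j (𝒮.low O j P) (𝒮.coord j P)) := by
        intro j hj
        have hl := length_of_descent hj
        by_cases hP : 𝒮.length O P < n
        · have hlow : 𝒮.length O (𝒮.low O j P) + 1 < n := by omega
          rw [hf0 P hP, hf0 _ (by omega), ← haG j _ hlow, ← move_congr (𝒮.adj_low O j P),
            move_coord]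
          exact eq_move ((hG.adj_iff hr (by omega) hP).mp (symm (𝒮.adj_low O j P)))
        · have hP' := not_lt.mp hP
          have hk := hq P hP'
          have hf := hf1 P hP'
          generalize q P hP' = k at hk hf
          by_cases hjk : j = k
          · rw [hjk]
            exact hf
          -- The two descents span a square. Constancy along walls makes the permutations on
          -- parallel sides equal, and moves of types j and k commute.
          have hadj := 𝒮.adj_of_descent hjk hj hk
          have hl' := length_of_descent hk
          have h1 := (ih _ (by omega) (𝒮.low O k P) rfl).1 j ((descent_low hadj).mpr hj)
          have h2 := (ih _ (by omega) (𝒮.low O j P) rfl).1 k ((descent_low hadj.symm).mpr hk)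
          rw [hf, h1, h2, 𝒮.low_low hadj, 𝒮.move_comm hadj,
            hastar k j (𝒮.low O k P) (Or.inr hadj.symm) ((descent_low hadj).mpr hj),
            hastar j k (𝒮.low O j P) (Or.inr hadj) ((descent_low hadj.symm).mpr hk),
            𝒮.low_low hadj, ← 𝒮.coord_eq hjk (𝒮.adj_low O k P),
            ← 𝒮.coord_eq (Ne.symm hjk) (𝒮.adj_low O j P)]
      refine ⟨hdesc, fun j => ?_⟩
      by_cases hP : 𝒮.length O P + 1 < n
      · rw [hf0 P ((Nat.lt_succ_self _).trans hP), ← haG j P hP, move_coord]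
      -- This case includes length n - 1: such a chamber is in the ball, but its residues may leave
      -- it, so its permutation is an inherited one.
      · obtain ⟨k, hk, hak⟩ := hapar j P (not_lt.mp hP)
        have hl := length_of_descent hk
        rw [hdesc k hk, hak]
        by_cases hjk : j = k
        · subst hjk
          rw [coord_move]
        · rw [𝒮.coord_move_of_ne hjk, (ih _ (by omega) (𝒮.low O k P) rfl).2 j,
            ← 𝒮.coord_eq hjk (𝒮.adj_low O k P)]
  have hflow : ∀ j P, f P = 𝒮.move j (f (𝒮.low O j P)) (a j (𝒮.low O j P) (𝒮.coord j P)) := by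
    intro j P
    by_cases hj : 𝒮.Descent O j P
    · exact (key _ P rfl).1 j hj
    · rw [𝒮.not_descent_iff.mp hj, ← (key _ P rfl).2 j, move_coord]
  have halow : ∀ j P, a j P = a j (𝒮.low O j P) := by
    intro j P
    by_cases hj : 𝒮.Descent O j P
    · exact hastar j j P (Or.inl rfl) hj
    · rw [𝒮.not_descent_iff.mp hj]
  have hmove : ∀ j P x, f (𝒮.move j P x) = 𝒮.move j (f P) (a j P x) := by
    intro j P x
    have h1 : 𝒮.adj j (f (𝒮.low O j P)) (f P) := by
      rw [hflow j P]
      exact 𝒮.adj_move _ _ _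
    rw [hflow j (𝒮.move j P x), ← low_congr (𝒮.adj_move j P x), coord_move, ← halow,
      move_congr h1]
  have hbij := 𝒮.bijective_of_move (f := f) (a := fun j P => a j P) (fun j P => (a j P).bijective)
    hmove
  have hadj : ∀ {j P Q}, 𝒮.adj j P Q ↔ 𝒮.adj j (f P) (f Q) := by
    intro j P Q
    constructor
    · intro h
      rw [eq_move h, hmove]
      exact 𝒮.adj_move _ _ _
    · intro h
      have h1 := hmove j P ((a j P).symm (𝒮.coord j (f Q)))
      rw [Equiv.apply_symm_apply, ← eq_move h] at h1
      rw [← hbij.1 h1]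
      exact 𝒮.adj_move _ _ _
  refine ⟨Equiv.ofBijective f hbij, fun s P Q => ?_, hf0⟩
  change _ ↔ 𝒮.adj s.1 (f P) (f Q) ∧ r s.1 s.2 (𝒮.coord s.1 (f P)) (𝒮.coord s.1 (f Q))
  rw [← hadj]
  refine and_congr_right fun h => ?_
  rw [(key _ P rfl).2, (key _ Q rfl).2, halow s.1 Q, ← low_congr h, ← halow, ← har]

end RightAngledSystem

/-! ### Spherical subsets -/

namespace Realization

variable {S : Type*} {M' : CoxeterMatrix S}

theorem finite_closure_pair {G : Type*} [Group G] {a b : G} (ha : a * a = 1) (hb : b * b = 1)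
    (hab : a * b = b * a) : (Subgroup.closure {a, b} : Set G).Finite := by
  have h : (Subgroup.closure {a, b} : Set G) ⊆ {1, a, b, a * b} := by
    intro x (hx : x ∈ Subgroup.closure {a, b})
    have ha' : a⁻¹ = a := inv_eq_of_mul_eq_one_left ha
    have hb' : b⁻¹ = b := inv_eq_of_mul_eq_one_left hb
    have haa : ∀ y, a * (a * y) = y := fun y => by rw [← mul_assoc, ha, one_mul]
    have hbb : ∀ y, b * (b * y) = y := fun y => by rw [← mul_assoc, hb, one_mul]
    have step : ∀ x ∈ ({a, b} : Set G), ∀ y ∈ ({1, a, b, a * b} : Set G),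
        x * y ∈ ({1, a, b, a * b} : Set G) := by
      rintro x (rfl | rfl) y (rfl | rfl | rfl | rfl) <;> simp [ha, hb, hab, hbb]
      simp [← hab, haa]
    have hinv : ∀ x ∈ ({a, b} : Set G), x⁻¹ = x := by
      rintro x (rfl | rfl) <;> assumption
    induction hx using Subgroup.closure_induction_left with
    | one => simp
    | mul_left x hx y _ ih => exact step x hx y ih
    | inv_mul_cancel x hx y _ ih =>
      rw [hinv x hx]
      exact step x hx y ih
  exact (Set.toFinite _).subset h

theorem simple_mul_self (s : S) : M'.simple s * M'.simple s = 1 := by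
  simpa using M'.toCoxeterSystem.simple_mul_simple_self s

/-- The spherical subset with a single element. -/
def Spherical.single (M' : CoxeterMatrix S) (s : S) : Spherical M' :=
  ⟨{s}, by
    have := finite_closure_pair (simple_mul_self (M' := M') s) (simple_mul_self s) rfl
    simpa using this⟩

theorem Spherical.single_le {s : S} {T : Spherical M'} : Spherical.single M' s ≤ T ↔ s ∈ T.1 :=
  Set.singleton_subset_iff

theorem finite_closure_of_subset {G H : Type*} [Group G] [Group H] (φ : G →* H) {A : Set G}
    {A' : Set H} (hA : (Subgroup.closure A : Set G).Finite)
    (h : ∀ a ∈ A', ∃ x ∈ Subgroup.closure A, φ x = a) :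
    (Subgroup.closure A' : Set H).Finite := by
  have h1 : Subgroup.closure A' ≤ (Subgroup.closure A).map φ := by
    rw [Subgroup.closure_le]
    exact h
  refine (hA.image φ).subset ?_
  intro x hx
  exact h1 hx

/-! ### Galleries -/

section

open Classical

variable {W B : Type*} [Group W] {σ : S → W} {δ : B → B → W} {base : B}

/-- Properties of a `W`-valued distance from which galleries are obtained. -/
structure HasGalleries (σ : S → W) (δ : B → B → W) : Prop where
  eq_of_one : ∀ {C D}, δ C D = 1 → C = D
  sq : ∀ s, σ s * σ s = 1
  step : ∀ C D s, ∃ C', δ C' C = σ s ∧ δ C' D = σ s * δ C D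

/-- A word for δ(C, D) in the generators from T is removed letter by letter with `step`, until the
distance is 1. -/
theorem HasGalleries.gallery_of_mem (h : HasGalleries σ δ) {T : Set S} {C D : B}
    (hCD : δ C D ∈ Subgroup.closure (σ '' T)) :
    Relation.ReflTransGen (fun C D => ∃ s ∈ T, vertex M' σ δ C (Spherical.single M' s) =
      vertex M' σ δ D (Spherical.single M' s)) C D := by
  generalize hw : δ C D = w at hCD
  have step : ∀ x ∈ σ '' T, ∀ w, (∀ C, δ C D = w →
      Relation.ReflTransGen (fun C D => ∃ s ∈ T, vertex M' σ δ C (Spherical.single M' s) =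
        vertex M' σ δ D (Spherical.single M' s)) C D) → ∀ C, δ C D = x * w →
      Relation.ReflTransGen (fun C D => ∃ s ∈ T, vertex M' σ δ C (Spherical.single M' s) =
        vertex M' σ δ D (Spherical.single M' s)) C D := by
    rintro _ ⟨s, hs, rfl⟩ w ih C hC
    obtain ⟨C', h1, h2⟩ := h.step C D s
    refine Relation.ReflTransGen.head ⟨s, hs, ?_⟩ (ih C' ?_)
    · refine (Quot.sound ⟨rfl, ?_⟩ : vertex M' σ δ C' _ = vertex M' σ δ C _).symm
      change δ C' C ∈ _
      rw [h1]
      exact Subgroup.subset_closure ⟨s, rfl, rfl⟩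
    · rw [h2, hC, ← mul_assoc, h.sq, one_mul]
  induction hCD using Subgroup.closure_induction_left generalizing C with
  | one =>
    rw [h.eq_of_one hw]
  | mul_left x hx y _ ih => exact step x hx y (fun C hC => ih hC) C hw
  | inv_mul_cancel x hx y _ ih =>
    have hx' : x⁻¹ = x := by
      obtain ⟨s, -, rfl⟩ := hx
      exact inv_eq_of_mul_eq_one_left (h.sq s)
    rw [hx'] at hw
    exact step x hx y (fun C hC => ih hC) C hw

theorem HasGalleries.gallery (h : HasGalleries σ δ) {T : Spherical M'} {C D : B}
    (hCD : vertex M' σ δ C T = vertex M' σ δ D T) :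
    Relation.ReflTransGen (fun C D => ∃ s ∈ T.1, vertex M' σ δ C (Spherical.single M' s) =
      vertex M' σ δ D (Spherical.single M' s)) C D := by
  have key : ∀ x y : B × Spherical M', Relation.EqvGen (fun x y : B × Spherical M' =>
      x.2 = y.2 ∧ δ x.1 y.1 ∈ Subgroup.closure (σ '' (x.2 : Set S))) x y →
      x.2 = y.2 ∧ Relation.ReflTransGen (fun C D => ∃ s ∈ x.2.1,
        vertex M' σ δ C (Spherical.single M' s) = vertex M' σ δ D (Spherical.single M' s))
        x.1 y.1 := by
    intro x y hxy
    induction hxy with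
    | rel x y hxy => exact ⟨hxy.1, h.gallery_of_mem hxy.2⟩
    | refl x => exact ⟨rfl, Relation.ReflTransGen.refl⟩
    | symm x y _ ih =>
      refine ⟨ih.1.symm, ?_⟩
      rw [← ih.1]
      refine Relation.ReflTransGen.mono ?_ _ _ ih.2.swap
      rintro C D ⟨s, hs, h⟩
      exact ⟨s, hs, h.symm⟩
    | trans x y z _ _ ih₁ ih₂ =>
      refine ⟨ih₁.1.trans ih₂.1, ih₁.2.trans ?_⟩
      rw [ih₁.1]
      exact ih₂.2
  exact (key _ _ (Quot.eqvGen_exact hCD)).2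

theorem HasGalleries.eq_of_vertex_empty (h : HasGalleries σ δ) {C D : B}
    (hCD : vertex M' σ δ C (Spherical.empty M') = vertex M' σ δ D (Spherical.empty M')) :
    C = D := by
  induction h.gallery hCD with
  | refl => rfl
  | tail _ h _ =>
    obtain ⟨s, hs, -⟩ := h
    exact absurd hs (Set.notMem_empty s)

/-! ### Equivalence and residues in the universal cover -/

namespace CoverChamber

/-- The vertex {s} is the least one in the s-mirror and so determines the mirror. -/
theorem equivalent_iff {s : S} {P Q : CoverChamber M' σ δ base} :
    Equivalent s P Q ↔ P.vertex (Spherical.single M' s) = Q.vertex (Spherical.single M' s) := by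
  constructor
  · intro h
    have h1 : P.vertex (Spherical.single M' s) ∈ Q.mirror s := by
      rw [← (h : P.mirror s = Q.mirror s)]
      exact ⟨_, rfl, rfl⟩
    obtain ⟨T, -, hT⟩ := h1
    have : T = Spherical.single M' s := congrArg Vertex.type (congrArg Sigma.fst hT)
    rw [← hT, this]
  · intro h
    exact Set.image_congr fun T hT => vertex_mono (Spherical.single_le.mpr hT) h

theorem Equivalent.symm {s : S} {P Q : CoverChamber M' σ δ base} (h : Equivalent s P Q) :
    Equivalent s Q P := Eq.symm h

theorem inResidue_of_vertex_eq (h : HasGalleries σ δ) {T : Spherical M'}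
    {P Q : CoverChamber M' σ δ base} (hPQ : P.vertex T = Q.vertex T) :
    ChamberSystem.InResidue Equivalent T.1 P Q := by
  have key : ∀ D, Relation.ReflTransGen (fun C D => ∃ s ∈ T.1,
      Realization.vertex M' σ δ C (Spherical.single M' s) =
        Realization.vertex M' σ δ D (Spherical.single M' s)) P.1 D →
      ∃ R : CoverChamber M' σ δ base, R.1 = D ∧ P.vertex T = R.vertex T ∧
        ChamberSystem.InResidue Equivalent T.1 P R := by
    intro D hD
    induction hD with
    | refl => exact ⟨P, rfl, rfl, Relation.ReflTransGen.refl⟩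
    | tail _ h ih =>
      obtain ⟨R, rfl, h1, h2⟩ := ih
      obtain ⟨s, hs, h⟩ := h
      obtain ⟨U, hU, rfl⟩ := R.exists_vertex_eq h
      exact ⟨U, rfl, h1.trans (vertex_mono (Spherical.single_le.mpr hs) hU),
        h2.tail ⟨s, hs, equivalent_iff.mpr hU⟩⟩
  obtain ⟨R, hR, h1, h2⟩ := key Q.1 (h.gallery (congrArg Sigma.fst hPQ))
  rwa [← eq_of_vertex_eq (h1.symm.trans hPQ) hR]

theorem eq_of_vertex_empty_eq (h : HasGalleries σ δ) {P Q : CoverChamber M' σ δ base}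
    (hPQ : P.vertex (Spherical.empty M') = Q.vertex (Spherical.empty M')) : P = Q :=
  eq_of_vertex_eq hPQ (h.eq_of_vertex_empty (congrArg Sigma.fst hPQ))

theorem inResidue_univ (h : HasGalleries σ δ) (P Q : CoverChamber M' σ δ base) :
    ChamberSystem.InResidue Equivalent Set.univ P Q := by
  have key : ∀ P : CoverChamber M' σ δ base,
      ChamberSystem.InResidue Equivalent Set.univ (origin M' σ δ base) P := by
    intro P
    refine Relation.ReflTransGen.trans_induction_on (motive := fun {P Q} _ =>
      ChamberSystem.InResidue Equivalent Set.univ P Q) P.reachable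
      (fun _ => Relation.ReflTransGen.refl) ?_ (fun _ _ => Relation.ReflTransGen.trans)
    rintro P Q ⟨T, hT⟩
    refine Relation.ReflTransGen.mono ?_ _ _ (inResidue_of_vertex_eq h hT)
    rintro P Q ⟨s, -, hs⟩
    exact ⟨s, trivial, hs⟩
  refine Relation.ReflTransGen.trans ?_ (key Q)
  refine Relation.ReflTransGen.mono ?_ _ _ (key P).swap
  rintro P Q ⟨s, hs, h⟩
  exact ⟨s, hs, h.symm⟩

end CoverChamber

end

end Realization

/-! ### Spherical subsets of graph products -/

namespace GraphProduct

open Realization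

section

open Classical

variable {I : Type*} {Γ : SimpleGraph I} {S : I → Type*} {M : ∀ i, CoxeterMatrix (S i)}

theorem coxeterMatrix_same (i : I) (s t : S i) : coxeterMatrix Γ M ⟨i, s⟩ ⟨i, t⟩ = M i s t := by
  change (if h : i = i then M i s (h ▸ t) else _) = _
  simp

theorem coxeterMatrix_of_ne {i j : I} (h : j ≠ i) (s : S i) (t : S j) :
    coxeterMatrix Γ M ⟨i, s⟩ ⟨j, t⟩ = if Γ.Adj i j then 2 else 0 := by
  change (if h : j = i then M i s (h ▸ t) else _) = _
  simp [h]

theorem exists_groupInclusion (Γ : SimpleGraph I) (M : ∀ i, CoxeterMatrix (S i)) (i : I) :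
    ∃ φ : (M i).Group →* (coxeterMatrix Γ M).Group,
      ∀ s, φ ((M i).simple s) = (coxeterMatrix Γ M).simple ⟨i, s⟩ := by
  have h : (M i).IsLiftable fun s => (coxeterMatrix Γ M).simple ⟨i, s⟩ := fun s t => by
    have := (coxeterMatrix Γ M).toCoxeterSystem.simple_mul_simple_pow ⟨i, s⟩ ⟨i, t⟩
    rwa [coxeterMatrix_same] at this
  exact ⟨_, (M i).toCoxeterSystem.lift_apply_simple h⟩

/-- A map on the generators extends to the graph product if its restrictions extend to the `W_i`
and the relations for adjacent vertices hold. -/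
theorem isLiftable {G : Type*} [Group G] (f : (Σ i, S i) → G)
    (h : ∀ i, (M i).IsLiftable fun s => f ⟨i, s⟩)
    (h' : ∀ p q : Σ i, S i, Γ.Adj p.1 q.1 → (f p * f q) ^ 2 = 1) :
    (coxeterMatrix Γ M).IsLiftable f := by
  rintro ⟨i, s⟩ ⟨j, t⟩
  by_cases hij : j = i
  · subst hij
    rw [coxeterMatrix_same]
    exact h j s t
  · rw [coxeterMatrix_of_ne hij]
    split_ifs with hadj
    · exact h' ⟨i, s⟩ ⟨j, t⟩ hadj
    · exact pow_zero _

theorem exists_groupRetraction (Γ : SimpleGraph I) (M : ∀ i, CoxeterMatrix (S i)) (i : I) :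
    ∃ φ : (coxeterMatrix Γ M).Group →* (M i).Group,
      ∀ s, φ ((coxeterMatrix Γ M).simple ⟨i, s⟩) = (M i).simple s := by
  let f : (Σ i, S i) → (M i).Group := fun p => if h : p.1 = i then (M i).simple (h ▸ p.2) else 1
  have hf : (coxeterMatrix Γ M).IsLiftable f := by
    refine isLiftable f (fun j s t => ?_) ?_
    · by_cases h : j = i
      · subst h
        simpa [f] using (M j).toCoxeterSystem.simple_mul_simple_pow s t
      · simp [f, h]
    · rintro ⟨j, s⟩ ⟨k, t⟩ hjk
      have hjk := hjk.ne
      by_cases hj : j = i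
      · subst hj
        have hk : ¬ k = j := fun h => hjk h.symm
        simpa [f, hk, sq] using simple_mul_self s
      · by_cases hk : k = i
        · subst hk
          simpa [f, hj, sq] using simple_mul_self t
        · simp [f, hj, hk]
  refine ⟨(coxeterMatrix Γ M).toCoxeterSystem.lift ⟨f, hf⟩, fun s => ?_⟩
  have h1 : f ⟨i, s⟩ = (M i).simple s := by simp [f]
  rw [← h1]
  exact (coxeterMatrix Γ M).toCoxeterSystem.lift_apply_simple hf ⟨i, s⟩

/-- Elements of a spherical subset have equal or adjacent types. -/
theorem adj_of_mem_spherical {T : Spherical (coxeterMatrix Γ M)} {s t : Σ i, S i} (hs : s ∈ T.1)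
    (ht : t ∈ T.1) : t.1 = s.1 ∨ Γ.Adj s.1 t.1 := by
  by_contra! h
  obtain ⟨hne, hadj⟩ := h
  -- Generators of the two non-adjacent types go to two reflections of the infinite dihedral group
  -- and all others to 1. Then the product of s and t maps to a rotation of infinite order, which a
  -- finite subgroup excludes.
  let f : (Σ i, S i) → DihedralGroup 0 := fun p =>
    if p.1 = s.1 then .sr 0 else if p.1 = t.1 then .sr 1 else 1
  have hsq : ∀ p, f p * f p = 1 := by
    intro p
    simp only [f]
    split_ifs <;> simp
  have hf : (coxeterMatrix Γ M).IsLiftable f := by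
    refine isLiftable f (fun i a b => ?_) (fun p q hpq => ?_)
    · change (f ⟨i, a⟩ * f ⟨i, a⟩) ^ _ = 1
      rw [hsq, one_pow]
    · have h1 : f p = 1 ∨ f q = 1 := by
        have := hpq.ne
        by_contra! hc
        simp only [f] at hc
        split_ifs at hc <;> simp_all [SimpleGraph.adj_comm]
      rcases h1 with h1 | h1
      · rw [h1, one_mul, sq, hsq]
      · rw [h1, mul_one, sq, hsq]
  let φ := (coxeterMatrix Γ M).toCoxeterSystem.lift ⟨f, hf⟩
  have hφ : ∀ p, φ ((coxeterMatrix Γ M).simple p) = f p := by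
    intro p
    simpa using (coxeterMatrix Γ M).toCoxeterSystem.lift_apply_simple hf p
  let x : (coxeterMatrix Γ M).Group := (coxeterMatrix Γ M).simple s * (coxeterMatrix Γ M).simple t
  have hx : x ∈ Subgroup.closure ((coxeterMatrix Γ M).simple '' T.1) :=
    mul_mem (Subgroup.subset_closure ⟨s, hs, rfl⟩) (Subgroup.subset_closure ⟨t, ht, rfl⟩)
  have hfin : IsOfFinOrder x := by
    have : Finite (Subgroup.closure ((coxeterMatrix Γ M).simple '' T.1)) := T.2
    exact (Subgroup.closure ((coxeterMatrix Γ M).simple '' T.1)).subtype.isOfFinOrder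
      (isOfFinOrder_of_finite ⟨x, hx⟩)
  have h1 : φ x = DihedralGroup.r 1 := by
    simp only [x, map_mul, hφ, f, if_true, if_neg hne]
    simp
  have h2 := (h1 ▸ φ.isOfFinOrder hfin).orderOf_pos
  rw [DihedralGroup.orderOf_r_one] at h2
  exact lt_irrefl _ h2

variable (Γ M) in
/-- The part of a spherical subset that lies in `S_i`. -/
def restrict (i : I) (T : Spherical (coxeterMatrix Γ M)) : Spherical (M i) :=
  ⟨{s | (⟨i, s⟩ : Σ i, S i) ∈ T.1}, by
    obtain ⟨φ, hφ⟩ := exists_groupRetraction Γ M i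
    refine finite_closure_of_subset φ T.2 ?_
    rintro _ ⟨s, hs, rfl⟩
    exact ⟨_, Subgroup.subset_closure ⟨_, hs, rfl⟩, hφ s⟩⟩

variable (Γ M) in
/-- A spherical subset of `S_i`, regarded as a subset of the disjoint union. -/
def extend (i : I) (T : Spherical (M i)) : Spherical (coxeterMatrix Γ M) :=
  ⟨Sigma.mk i '' T.1, by
    obtain ⟨φ, hφ⟩ := exists_groupInclusion Γ M i
    refine finite_closure_of_subset φ T.2 ?_
    rintro _ ⟨_, ⟨s, hs, rfl⟩, rfl⟩
    exact ⟨_, Subgroup.subset_closure ⟨_, hs, rfl⟩, hφ s⟩⟩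

theorem restrict_extend (i : I) (T : Spherical (M i)) : restrict Γ M i (extend Γ M i T) = T := by
  ext s
  simp [restrict, extend]

theorem restrict_mono {i : I} {T T' : Spherical (coxeterMatrix Γ M)} (h : T ≤ T') :
    restrict Γ M i T ≤ restrict Γ M i T' := fun _ hs => h hs

theorem extend_mono {i : I} {T T' : Spherical (M i)} (h : T ≤ T') :
    extend Γ M i T ≤ extend Γ M i T' := Set.image_mono h

theorem extend_single (i : I) (s : S i) :
    extend Γ M i (Spherical.single (M i) s) = Spherical.single _ ⟨i, s⟩ :=
  Subtype.ext Set.image_singleton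

theorem restrict_single (i : I) (s : S i) :
    restrict Γ M i (Spherical.single _ ⟨i, s⟩) = Spherical.single (M i) s := by
  rw [← extend_single, restrict_extend]

theorem restrict_eq_empty {i : I} {T : Spherical (coxeterMatrix Γ M)} (h : ∀ s ∈ T.1, s.1 ≠ i) :
    restrict Γ M i T = Spherical.empty (M i) :=
  Subtype.ext (Set.eq_empty_of_forall_notMem fun s hs => h ⟨i, s⟩ hs rfl)

theorem exists_spherical_pair {i j : I} (h : Γ.Adj i j) (s : S i) (t : S j) :
    ∃ T : Spherical (coxeterMatrix Γ M), ⟨i, s⟩ ∈ T.1 ∧ ⟨j, t⟩ ∈ T.1 := by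
  refine ⟨⟨{⟨i, s⟩, ⟨j, t⟩}, ?_⟩, by simp, by simp⟩
  rw [Set.image_pair]
  refine finite_closure_pair (simple_mul_self _) (simple_mul_self _) ?_
  have h1 : ((coxeterMatrix Γ M).simple ⟨i, s⟩ * (coxeterMatrix Γ M).simple ⟨j, t⟩) ^ 2 = 1 := by
    have := (coxeterMatrix Γ M).toCoxeterSystem.simple_mul_simple_pow ⟨i, s⟩ ⟨j, t⟩
    rwa [coxeterMatrix_of_ne h.ne.symm, if_pos h] at this
  rw [sq] at h1
  rw [← inv_eq_of_mul_eq_one_left h1, mul_inv_rev, inv_eq_of_mul_eq_one_left (simple_mul_self _),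
    inv_eq_of_mul_eq_one_left (simple_mul_self _)]

end

end GraphProduct

/-! ### Graph products of buildings are right-angled chamber systems -/

namespace GraphProduct

open Realization

section

open Classical

variable {I : Type*} {Γ : SimpleGraph I} {S W : I → Type*} [∀ i, Group (W i)]
  {M : ∀ i, CoxeterMatrix (S i)} {cs : ∀ i, CoxeterSystem (M i) (W i)} {B : I → Type*}
  {Φ : ∀ i, Building (cs i) (B i)} {base : ∀ i, B i}

theorem _root_.Building.hasGalleries {S W : Type*} [Group W] {M : CoxeterMatrix S}
    {cs : CoxeterSystem M W} {B : Type*} (Φ : Building cs B) : HasGalleries cs.simple Φ.δ where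
  eq_of_one h := (Φ.wd1 _ _).mp h
  sq := cs.simple_mul_simple_self
  step := Φ.wd3

theorem prodDist_update (C : ∀ i, B i) (i : I) (x y : B i) :
    prodDist Φ (Function.update C i x) (Function.update C i y) =
      Pi.mulSingle i ((Φ i).δ x y) := by
  funext j
  by_cases h : j = i
  · subst h
    simp [prodDist]
  · simp [prodDist, h, (Φ j).wd1]

variable (Φ) in
theorem hasGalleries_prod : HasGalleries (prodSimple cs) (prodDist Φ) where
  eq_of_one h := funext fun i => ((Φ i).wd1 _ _).mp (congrFun h i)
  sq s := by
    rw [prodSimple, ← Pi.mulSingle_mul, (cs s.1).simple_mul_simple_self, Pi.mulSingle_one]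
  step C D s := by
    obtain ⟨i, s⟩ := s
    obtain ⟨c, h1, h2⟩ := (Φ i).wd3 (C i) (D i) s
    refine ⟨Function.update C i c, ?_, ?_⟩
    · have := prodDist_update (Φ := Φ) C i c (C i)
      rwa [Function.update_eq_self, h1] at this
    · funext j
      by_cases h : j = i
      · subst h
        simpa [prodDist, prodSimple] using h2
      · simp [prodDist, prodSimple, h]

/-- The i-th projection of the direct product kills the generators of other types, so it maps the
subgroup of T into that of its part in S_i. -/
theorem vertex_restrict {C D : ∀ i, B i} {T : Spherical (coxeterMatrix Γ M)}
    (h : Realization.vertex _ (prodSimple cs) (prodDist Φ) C T =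
      Realization.vertex _ (prodSimple cs) (prodDist Φ) D T) (i : I) :
    Realization.vertex (M i) (cs i).simple (Φ i).δ (C i) (restrict Γ M i T) =
      Realization.vertex (M i) (cs i).simple (Φ i).δ (D i) (restrict Γ M i T) := by
  refine congrArg (Quot.map (fun x : (∀ i, B i) × Spherical (coxeterMatrix Γ M) =>
    (x.1 i, restrict Γ M i x.2)) ?_) h
  rintro ⟨C, T⟩ ⟨D, T'⟩ ⟨h1, h2⟩
  dsimp only at h1 h2
  subst h1
  refine ⟨rfl, ?_⟩
  have hle : (Subgroup.closure (prodSimple cs '' T.1)).map (Pi.evalMonoidHom W i) ≤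
      Subgroup.closure ((cs i).simple '' (restrict Γ M i T).1) := by
    rw [MonoidHom.map_closure, Subgroup.closure_le]
    rintro _ ⟨_, ⟨⟨j, s⟩, hs, rfl⟩, rfl⟩
    by_cases hj : j = i
    · subst hj
      refine Subgroup.subset_closure ⟨s, hs, ?_⟩
      simp [prodSimple]
    · have : Pi.evalMonoidHom W i (prodSimple cs ⟨j, s⟩) = 1 := by
        simp [prodSimple, Pi.mulSingle_eq_of_ne (fun h : i = j => hj h.symm)]
      rw [this]
      exact one_mem _
  exact hle ⟨_, h2, rfl⟩

theorem vertex_extend (C : ∀ i, B i) {i : I} {x y : B i} {T : Spherical (M i)}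
    (h : Realization.vertex (M i) (cs i).simple (Φ i).δ x T =
      Realization.vertex (M i) (cs i).simple (Φ i).δ y T) :
    Realization.vertex _ (prodSimple cs) (prodDist Φ) (Function.update C i x) (extend Γ M i T) =
      Realization.vertex _ (prodSimple cs) (prodDist Φ) (Function.update C i y)
        (extend Γ M i T) := by
  refine congrArg (Quot.map (fun x : B i × Spherical (M i) =>
    (Function.update C i x.1, extend Γ M i x.2)) ?_) h
  rintro ⟨x, T⟩ ⟨y, T'⟩ ⟨h1, h2⟩
  dsimp only at h1 h2
  subst h1
  refine ⟨rfl, ?_⟩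
  have hle : (Subgroup.closure ((cs i).simple '' T.1)).map (MonoidHom.mulSingle W i) ≤
      Subgroup.closure (prodSimple cs '' (extend Γ M i T).1) := by
    rw [MonoidHom.map_closure, Subgroup.closure_le]
    rintro _ ⟨_, ⟨s, hs, rfl⟩, rfl⟩
    exact Subgroup.subset_closure ⟨⟨i, s⟩, ⟨s, hs, rfl⟩, rfl⟩
  dsimp only
  rw [prodDist_update]
  exact hle ⟨_, h2, rfl⟩

theorem vertex_update {C D : ∀ i, B i} {i : I} {s : S i}
    (h : Realization.vertex (coxeterMatrix Γ M) (prodSimple cs) (prodDist Φ) C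
      (Spherical.single _ ⟨i, s⟩) = Realization.vertex _ (prodSimple cs) (prodDist Φ) D
      (Spherical.single _ ⟨i, s⟩)) (E : ∀ i, B i) :
    Realization.vertex (coxeterMatrix Γ M) (prodSimple cs) (prodDist Φ) (Function.update E i (C i))
      (Spherical.single _ ⟨i, s⟩) = Realization.vertex _ (prodSimple cs) (prodDist Φ)
      (Function.update E i (D i)) (Spherical.single _ ⟨i, s⟩) := by
  have h1 := vertex_restrict h i
  rw [restrict_single] at h1
  have h2 := vertex_extend (Γ := Γ) E h1
  rwa [extend_single] at h2

/-! ### Coordinates and sections of residues -/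

/-- The chambers of the universal cover of the Davis realization of the building `B_i`. -/
abbrev Factor (Φ : ∀ i, Building (cs i) (B i)) (base : ∀ i, B i) (i : I) : Type _ :=
  CoverChamber (M i) (cs i).simple (Φ i).δ (base i)

/-- The covering of the product by pairs of a chamber of the product and a chamber of a factor. -/
def factorCovering (Γ : SimpleGraph I) (Φ : ∀ i, Building (cs i) (B i)) (base : ∀ i, B i) (i : I) :
    Covering (coxeterMatrix Γ M) (prodSimple cs) (prodDist Φ)
      {y : (∀ i, B i) × Factor Φ base i // y.2.1 = y.1 i} where
  proj y := y.1.1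
  rel T y y' := Realization.vertex _ (prodSimple cs) (prodDist Φ) y.1.1 T =
      Realization.vertex _ (prodSimple cs) (prodDist Φ) y'.1.1 T ∧
    y.1.2.vertex (restrict Γ M i T) = y'.1.2.vertex (restrict Γ M i T)
  equiv _ := ⟨fun _ => ⟨rfl, rfl⟩, fun h => ⟨h.1.symm, h.2.symm⟩,
    fun h h' => ⟨h.1.trans h'.1, h.2.trans h'.2⟩⟩
  mono hT h := ⟨vertex_congr_of_le hT h.1, CoverChamber.vertex_mono (restrict_mono hT) h.2⟩
  vertex_eq h := h.1
  lift {T y D} h := by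
    have h1 := vertex_restrict h i
    rw [← y.2] at h1
    obtain ⟨x, hx, hxD⟩ := y.1.2.exists_vertex_eq h1
    exact ⟨⟨(D, x), hxD⟩, ⟨h, hx⟩, rfl⟩
  inj {T y y'} h h' := by
    obtain ⟨⟨C, x⟩, hx⟩ := y
    obtain ⟨⟨D, y⟩, hy⟩ := y'
    dsimp only at hx hy h h'
    subst h'
    have := CoverChamber.eq_of_vertex_eq h.2 (hx.trans hy.symm)
    subst this
    rfl

theorem exists_coord (Γ : SimpleGraph I) (Φ : ∀ i, Building (cs i) (B i)) (base : ∀ i, B i)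
    (i : I) : ∃ c : Chamber Γ Φ base → Factor Φ base i, (∀ P, (c P).1 = P.1 i) ∧
      ∀ T P Q, P.vertex T = Q.vertex T →
        (c P).vertex (restrict Γ M i T) = (c Q).vertex (restrict Γ M i T) := by
  obtain ⟨F, hF, -⟩ := Covering.exists_isLift_origin (𝒴 := factorCovering Γ Φ base i)
    (y₀ := ⟨(base, CoverChamber.origin _ _ _ _), rfl⟩) rfl
  refine ⟨fun P => (F P).1.2, fun P => ?_, fun T P Q h => (hF.rel h).2⟩
  rw [(F P).2]
  exact congrFun (hF.proj P) i

/-- The coordinate of a chamber of the graph product in a factor. -/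
noncomputable def coord (i : I) (P : Chamber Γ Φ base) : Factor Φ base i :=
  (exists_coord Γ Φ base i).choose P

theorem coord_fst (i : I) (P : Chamber Γ Φ base) : (coord i P).1 = P.1 i :=
  (exists_coord Γ Φ base i).choose_spec.1 P

theorem coord_vertex (i : I) {P Q : Chamber Γ Φ base} {T : Spherical (coxeterMatrix Γ M)}
    (h : P.vertex T = Q.vertex T) :
    (coord i P).vertex (restrict Γ M i T) = (coord i Q).vertex (restrict Γ M i T) :=
  (exists_coord Γ Φ base i).choose_spec.2 T P Q h

theorem coord_eq_of_vertex_eq {i : I} {P Q : Chamber Γ Φ base} {T : Spherical (coxeterMatrix Γ M)}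
    (h : P.vertex T = Q.vertex T) (hT : ∀ s ∈ T.1, s.1 ≠ i) : coord i P = coord i Q := by
  have h1 := coord_vertex i h
  rw [restrict_eq_empty hT] at h1
  exact CoverChamber.eq_of_vertex_empty_eq (Φ i).hasGalleries h1

/-- The covering of a factor by the chambers of the graph product with fixed other
components. -/
def residueCovering (P : Chamber Γ Φ base) (i : I) :
    Covering (M i) (cs i).simple (Φ i).δ {Q : Chamber Γ Φ base // ∀ j, j ≠ i → Q.1 j = P.1 j} where
  proj Q := Q.1.1 i
  rel T Q Q' := Q.1.vertex (extend Γ M i T) = Q'.1.vertex (extend Γ M i T)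
  equiv _ := ⟨fun _ => rfl, Eq.symm, Eq.trans⟩
  mono hT h := CoverChamber.vertex_mono (extend_mono hT) h
  vertex_eq {T Q Q'} h := by
    have := vertex_restrict (congrArg Sigma.fst h) i
    rwa [restrict_extend] at this
  lift {T Q x} h := by
    have h1 := vertex_extend (Γ := Γ) Q.1.1 h
    rw [Function.update_eq_self] at h1
    obtain ⟨R, hR, hRx⟩ := Q.1.exists_vertex_eq h1
    refine ⟨⟨R, fun j hj => ?_⟩, hR, ?_⟩
    · rw [hRx, Function.update_of_ne hj, Q.2 j hj]
    · change R.1 i = x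
      rw [hRx, Function.update_self]
  inj {T Q Q'} h h' := by
    refine Subtype.ext (CoverChamber.eq_of_vertex_eq h (funext fun j => ?_))
    by_cases hj : j = i
    · subst hj
      exact h'
    · rw [Q.2 j hj, Q'.2 j hj]

/-- Lifting the universal cover of the factor to `residueCovering` produces θ, which parametrises
the i-residue of P. -/
theorem exists_section (P : Chamber Γ Φ base) (i : I) : ∃ θ : Factor Φ base i → Chamber Γ Φ base,
    θ (coord i P) = P ∧ (∀ x j, j ≠ i → (θ x).1 j = P.1 j) ∧ (∀ x, coord i (θ x) = x) ∧
      ∀ s x y, CoverChamber.Equivalent s x y → Equivalent ⟨i, s⟩ (θ x) (θ y) := by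
  obtain ⟨F, hF, hFP⟩ := Covering.exists_isLift (𝒴 := residueCovering P i)
    (P₀ := coord i P) (y₀ := ⟨P, fun _ _ => rfl⟩) (coord_fst i P).symm
  refine ⟨fun x => (F x).1, congrArg Subtype.val hFP, fun x => (F x).2, ?_, ?_⟩
  -- The composite of θ with the coordinate is a lift of the factor to itself that fixes one
  -- chamber, hence the identity.
  · have h1 : (CoverChamber.covering (M i) (cs i).simple (Φ i).δ (base i)).IsLift
        fun x => coord i (F x).1 :=
      ⟨fun x => (coord_fst i _).trans (hF.proj x), fun {T x y} h => by
        have := coord_vertex i (hF.rel h)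
        rwa [restrict_extend] at this⟩
    have h2 : (CoverChamber.covering (M i) (cs i).simple (Φ i).δ (base i)).IsLift id :=
      ⟨fun _ => rfl, fun h => h⟩
    exact congrFun (h1.eq h2 (P₀ := coord i P) (by
      change coord i (F (coord i P)).1 = coord i P
      rw [hFP]))
  · intro s x y h
    rw [CoverChamber.equivalent_iff] at h
    refine CoverChamber.equivalent_iff.mpr ?_
    rw [← extend_single]
    exact hF.rel h

theorem coord_eq_of_equivalent {i : I} {s : Σ i, S i} (hs : s.1 ≠ i) {P Q : Chamber Γ Φ base}
    (h : Equivalent s P Q) : coord i P = coord i Q := by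
  refine coord_eq_of_vertex_eq (CoverChamber.equivalent_iff.mp h) ?_
  rintro t rfl
  exact hs

theorem coord_equivalent {i : I} {s : S i} {P Q : Chamber Γ Φ base} (h : Equivalent ⟨i, s⟩ P Q) :
    CoverChamber.Equivalent s (coord i P) (coord i Q) := by
  have := coord_vertex i (CoverChamber.equivalent_iff.mp h)
  rw [restrict_single] at this
  exact CoverChamber.equivalent_iff.mpr this

theorem iEquivalent_equivalence (i : I) :
    Equivalence (IEquivalent (Γ := Γ) (Φ := Φ) (base := base) i) :=
  ⟨fun _ => Relation.ReflTransGen.refl, fun h => by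
    refine Relation.ReflTransGen.mono ?_ _ _ h.swap
    rintro P Q ⟨s, hs, h⟩
    exact ⟨s, hs, h.symm⟩, Relation.ReflTransGen.trans⟩

theorem coord_eq_of_iEquivalent {i j : I} (hij : i ≠ j) {P Q : Chamber Γ Φ base}
    (h : IEquivalent j P Q) : coord i P = coord i Q := by
  induction h with
  | refl => rfl
  | tail _ h ih =>
    obtain ⟨s, rfl, h⟩ := h
    exact ih.trans (coord_eq_of_equivalent hij.symm h)

theorem iEquivalent_section {i : I} {θ : Factor Φ base i → Chamber Γ Φ base}
    (hθ : ∀ s x y, CoverChamber.Equivalent s x y → Equivalent ⟨i, s⟩ (θ x) (θ y))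
    (x y : Factor Φ base i) : IEquivalent i (θ x) (θ y) := by
  refine Relation.ReflTransGen.lift θ ?_ _ _ (CoverChamber.inResidue_univ (Φ i).hasGalleries x y)
  rintro x y ⟨s, -, h⟩
  exact ⟨⟨i, s⟩, rfl, hθ s x y h⟩

/-- In the inductive step, R and the value of θ at its coordinate are both s-equivalent to Q and lie
over the same chamber of the product, so they coincide. -/
theorem eq_section {i : I} {P Q : Chamber Γ Φ base} {θ : Factor Φ base i → Chamber Γ Φ base}
    (hP : θ (coord i P) = P) (hfst : ∀ x j, j ≠ i → (θ x).1 j = P.1 j)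
    (hcoord : ∀ x, coord i (θ x) = x)
    (hθ : ∀ s x y, CoverChamber.Equivalent s x y → Equivalent ⟨i, s⟩ (θ x) (θ y))
    (h : IEquivalent i P Q) : θ (coord i Q) = Q := by
  induction h with
  | refl => exact hP
  | @tail Q R hPQ h ih =>
    have hPR : IEquivalent i P R := hPQ.tail h
    obtain ⟨⟨i, s⟩, rfl, h⟩ := h
    have h1 := hθ s _ _ (coord_equivalent h)
    rw [ih] at h1
    refine CoverChamber.eq_of_vertex_eq (CoverChamber.equivalent_iff.mp (h1.symm.trans h)) ?_
    funext j
    by_cases hj : j = i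
    · subst hj
      rw [← coord_fst, hcoord, coord_fst]
    · rw [hfst _ j hj, ← coord_fst, ← coord_fst, coord_eq_of_iEquivalent hj hPR]

theorem exists_iEquivalent (i : I) (P : Chamber Γ Φ base) (x : Factor Φ base i) :
    ∃ Q, IEquivalent i P Q ∧ coord i Q = x := by
  obtain ⟨θ, h1, -, h3, h4⟩ := exists_section P i
  refine ⟨θ x, ?_, h3 x⟩
  have := iEquivalent_section h4 (coord i P) x
  rwa [h1] at this

theorem eq_of_coord_eq {i : I} {P Q : Chamber Γ Φ base} (h : IEquivalent i P Q)
    (h' : coord i P = coord i Q) : P = Q := by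
  obtain ⟨θ, h1, h2, h3, h4⟩ := exists_section P i
  rw [← eq_section h1 h2 h3 h4 h, ← h', h1]

theorem equivalent_iff_coord {i : I} {s : S i} {P Q : Chamber Γ Φ base} :
    Equivalent ⟨i, s⟩ P Q ↔
      IEquivalent i P Q ∧ CoverChamber.Equivalent s (coord i P) (coord i Q) := by
  constructor
  · exact fun h => ⟨Relation.ReflTransGen.single ⟨_, rfl, h⟩, coord_equivalent h⟩
  · rintro ⟨h, h'⟩
    obtain ⟨θ, h1, h2, h3, h4⟩ := exists_section P i
    have := h4 s _ _ h'
    rwa [h1, eq_section h1 h2 h3 h4 h] at this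

/-! #### Squares -/

/-- Since {s, t} is spherical, both ways round the square end in one residue with the same
projection, and projections are injective on residues. -/
theorem exists_square {i j : I} (hij : Γ.Adj i j) {s : S i} {t : S j} {P Q R : Chamber Γ Φ base}
    (hQ : Equivalent ⟨i, s⟩ P Q) (hR : Equivalent ⟨j, t⟩ P R) :
    ∃ U, Equivalent ⟨j, t⟩ Q U ∧ Equivalent ⟨i, s⟩ R U := by
  obtain ⟨T, hs, ht⟩ := exists_spherical_pair (M := M) hij s t
  have hQ' := CoverChamber.equivalent_iff.mp hQ
  have hR' := CoverChamber.equivalent_iff.mp hR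
  have hQc : ∀ k, k ≠ i → P.1 k = Q.1 k := fun k hk => by
    rw [← coord_fst, ← coord_fst, coord_eq_of_equivalent hk.symm hQ]
  have hRc : ∀ k, k ≠ j → P.1 k = R.1 k := fun k hk => by
    rw [← coord_fst, ← coord_fst, coord_eq_of_equivalent hk.symm hR]
  have h1 := vertex_update (congrArg Sigma.fst hR') Q.1
  rw [hQc j hij.ne.symm, Function.update_eq_self] at h1
  have h2 := vertex_update (congrArg Sigma.fst hQ') R.1
  rw [hRc i hij.ne, Function.update_eq_self] at h2
  obtain ⟨U, hU, hUf⟩ := Q.exists_vertex_eq h1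
  obtain ⟨V, hV, hVf⟩ := R.exists_vertex_eq h2
  have hUV : U = V := by
    refine CoverChamber.eq_of_vertex_eq (T := T) ?_ ?_
    · have a1 := CoverChamber.vertex_mono (Spherical.single_le.mpr hs) hQ'
      have a2 := CoverChamber.vertex_mono (Spherical.single_le.mpr ht) hR'
      have a3 := CoverChamber.vertex_mono (Spherical.single_le.mpr ht) hU
      have a4 := CoverChamber.vertex_mono (Spherical.single_le.mpr hs) hV
      exact a3.symm.trans (a1.symm.trans (a2.trans a4))
    · rw [hUf, hVf]
      funext k
      by_cases hki : k = i
      · subst hki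
        rw [Function.update_of_ne hij.ne, Function.update_self]
      · rw [Function.update_of_ne hki]
        by_cases hkj : k = j
        · subst hkj
          rw [Function.update_self]
        · rw [Function.update_of_ne hkj, ← hQc k hki, hRc k hkj]
  exact ⟨U, CoverChamber.equivalent_iff.mpr hU, CoverChamber.equivalent_iff.mpr (hUV ▸ hV)⟩

theorem exists_iEquivalent_square {i j : I} (hij : Γ.Adj i j) {P Q R : Chamber Γ Φ base}
    (hQ : IEquivalent i P Q) (hR : IEquivalent j P R) :
    ∃ U, IEquivalent j Q U ∧ IEquivalent i R U := by
  have strip : ∀ {s : S i} {P Q R : Chamber Γ Φ base}, Equivalent ⟨i, s⟩ P Q →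
      IEquivalent j P R → ∃ U, IEquivalent j Q U ∧ Equivalent ⟨i, s⟩ R U := by
    intro s P Q R hQ hR
    induction hR with
    | refl => exact ⟨Q, Relation.ReflTransGen.refl, hQ⟩
    | tail _ h ih =>
      obtain ⟨U, h1, h2⟩ := ih
      obtain ⟨⟨j, t⟩, rfl, h⟩ := h
      obtain ⟨V, h3, h4⟩ := exists_square hij h2 h
      exact ⟨V, h1.tail ⟨_, rfl, h3⟩, h4⟩
  induction hQ with
  | refl => exact ⟨R, hR, Relation.ReflTransGen.refl⟩
  | tail _ h ih =>
    obtain ⟨U, h1, h2⟩ := ih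
    obtain ⟨⟨i, s⟩, rfl, h⟩ := h
    obtain ⟨V, h3, h4⟩ := strip h h1
    exact ⟨V, h3, h2.tail ⟨_, rfl, h4⟩⟩

/-! #### Sectors -/

theorem sameWall_iff {i : I} {K P Q : Chamber Γ Φ base} {j : I} (hj : j = i ∨ Γ.Adj i j)
    (h : IEquivalent j P Q) : SameWall Γ IEquivalent i K P ↔ SameWall Γ IEquivalent i K Q :=
  ⟨fun h' => h'.tail ⟨j, hj, h⟩,
    fun h' => h'.tail ⟨j, hj, (iEquivalent_equivalence j).symm h⟩⟩

/-- The change of the `i`-coordinate, when moving inside the wall of type `i` of `K`. -/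
noncomputable def crossing (i : I) (K P Q : Chamber Γ Φ base) : Factor Φ base i →₀ ℤ :=
  if SameWall Γ IEquivalent i K P ∧ SameWall Γ IEquivalent i K Q then
    Finsupp.single (coord i Q) 1 - Finsupp.single (coord i P) 1
  else 0

theorem crossing_of_coord_eq {i : I} {K P Q : Chamber Γ Φ base} (h : coord i P = coord i Q) :
    crossing i K P Q = 0 := by
  rw [crossing, h, sub_self, ite_self]

/-- The cocycle condition. If T avoids S_i, the coordinate is constant. Otherwise all types in T lie
in the star of i, so the residue is contained in the wall or disjoint from it; the sum telescopes or
vanishes. -/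
theorem crossing_add {i : I} {K P Q R : Chamber Γ Φ base} {T : Spherical (coxeterMatrix Γ M)}
    (hPQ : P.vertex T = Q.vertex T) (hQR : Q.vertex T = R.vertex T) :
    crossing i K P Q + crossing i K Q R = crossing i K P R := by
  by_cases hT : ∀ s ∈ T.1, s.1 ≠ i
  · rw [crossing_of_coord_eq (coord_eq_of_vertex_eq hPQ hT),
      crossing_of_coord_eq (coord_eq_of_vertex_eq hQR hT),
      crossing_of_coord_eq (coord_eq_of_vertex_eq (hPQ.trans hQR) hT), add_zero]
  · push Not at hT
    obtain ⟨s, hs, rfl⟩ := hT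
    have key : ∀ {P Q : Chamber Γ Φ base}, P.vertex T = Q.vertex T →
        (SameWall Γ IEquivalent s.1 K P ↔ SameWall Γ IEquivalent s.1 K Q) := by
      intro P Q h
      have h1 := CoverChamber.inResidue_of_vertex_eq (hasGalleries_prod Φ) h
      clear h
      induction h1 with
      | refl => exact Iff.rfl
      | tail _ h ih =>
        obtain ⟨t, ht, h⟩ := h
        exact ih.trans (sameWall_iff (adj_of_mem_spherical hs ht)
          (Relation.ReflTransGen.single ⟨t, rfl, h⟩))
    rw [crossing, crossing, crossing, ← key hQR, ← key hPQ]
    split_ifs <;> simp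

/-- The covering of the graph product by its product with a free abelian group, twisted by the
cocycle that counts crossings of a wall. -/
noncomputable def crossingCovering (i : I) (K : Chamber Γ Φ base) :
    Covering (coxeterMatrix Γ M) (prodSimple cs) (prodDist Φ)
      (Chamber Γ Φ base × (Factor Φ base i →₀ ℤ)) where
  proj y := y.1.1
  rel T y y' := y.1.vertex T = y'.1.vertex T ∧ y'.2 = y.2 + crossing i K y.1 y'.1
  equiv _ := ⟨fun y => ⟨rfl, by rw [crossing_of_coord_eq rfl, add_zero]⟩,
    fun {y y'} h => ⟨h.1.symm, by
      rw [h.2, add_assoc, crossing_add h.1 h.1.symm, crossing_of_coord_eq rfl, add_zero]⟩,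
    fun h h' => ⟨h.1.trans h'.1, by rw [h'.2, h.2, add_assoc, crossing_add h.1 h'.1]⟩⟩
  mono hT h := ⟨CoverChamber.vertex_mono hT h.1, h.2⟩
  vertex_eq h := congrArg Sigma.fst h.1
  lift {T y D} h := by
    obtain ⟨Q, hQ, hQD⟩ := y.1.exists_vertex_eq h
    exact ⟨(Q, y.2 + crossing i K y.1 Q), ⟨hQ, rfl⟩, hQD⟩
  inj {T y y'} h h' := by
    have h1 := CoverChamber.eq_of_vertex_eq h.1 h'
    refine Prod.ext h1 ?_
    rw [h.2, crossing_of_coord_eq (by rw [h1]), add_zero]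

theorem connected (P Q : Chamber Γ Φ base) :
    Relation.ReflTransGen (fun P Q : Chamber Γ Φ base => ∃ i, IEquivalent i P Q) P Q := by
  refine Relation.ReflTransGen.mono ?_ _ _ (CoverChamber.inResidue_univ (hasGalleries_prod Φ) P Q)
  rintro P Q ⟨s, -, h⟩
  exact ⟨s.1, Relation.ReflTransGen.single ⟨s, rfl, h⟩⟩

/-- Walls separate because the universal cover is simply connected: lifting to `crossingCovering`
gives a potential for the crossing cocycle. Normalised at K, it equals the basis vector of the
coordinate on the wall and changes nowhere else, so it is always a basis vector, whose index is the
sector. -/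
theorem exists_sector (i : I) (K : Chamber Γ Φ base) : ∃ sec : Chamber Γ Φ base → Factor Φ base i,
    (∀ P, SameWall Γ IEquivalent i K P → sec P = coord i P) ∧
      ∀ j P Q, IEquivalent j P Q → (j ≠ i ∨ ¬ SameWall Γ IEquivalent i K P) → sec P = sec Q := by
  obtain ⟨F, hF, hFK⟩ := Covering.exists_isLift (𝒴 := crossingCovering i K)
    (P₀ := K) (y₀ := (K, Finsupp.single (coord i K) 1)) rfl
  have hF1 : ∀ P, (F P).1 = P := by
    have h1 : (CoverChamber.covering (coxeterMatrix Γ M) (prodSimple cs) (prodDist Φ) base).IsLift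
        fun P => (F P).1 := ⟨hF.proj, fun h => (hF.rel h).1⟩
    have h2 : (CoverChamber.covering (coxeterMatrix Γ M) (prodSimple cs) (prodDist Φ) base).IsLift
        id := ⟨fun _ => rfl, fun h => h⟩
    exact congrFun (h1.eq h2 (P₀ := K) (congrArg Prod.fst hFK))
  have hstep : ∀ {s} {P Q : Chamber Γ Φ base}, Equivalent s P Q →
      (F Q).2 = (F P).2 + crossing i K P Q := by
    intro s P Q h
    have := (hF.rel (CoverChamber.equivalent_iff.mp h)).2
    rwa [hF1, hF1] at this
  have hconst : ∀ {j} {P Q : Chamber Γ Φ base}, IEquivalent j P Q →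
      (j ≠ i ∨ ¬ SameWall Γ IEquivalent i K P) → (F P).2 = (F Q).2 := by
    intro j P Q h hj
    induction h with
    | refl => rfl
    | @tail Q R hPQ h ih =>
      obtain ⟨s, rfl, h⟩ := h
      rw [ih, hstep h]
      by_cases hs : s.1 = i
      · have h1 := hj.resolve_left (not_not.mpr hs)
        rw [sameWall_iff (Or.inl hs) hPQ] at h1
        rw [crossing, if_neg (fun h => h1 h.1), add_zero]
      · rw [crossing_of_coord_eq (coord_eq_of_equivalent hs h), add_zero]
  have hcross : ∀ {P Q : Chamber Γ Φ base}, IEquivalent i P Q → SameWall Γ IEquivalent i K P →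
      (F P).2 = Finsupp.single (coord i P) 1 → (F Q).2 = Finsupp.single (coord i Q) 1 := by
    intro P Q h hP hFP
    induction h with
    | refl => exact hFP
    | @tail Q R hPQ h ih =>
      obtain ⟨s, hs, h⟩ := h
      have hQ := (sameWall_iff (Or.inl rfl) hPQ).mp hP
      have hR := (sameWall_iff (Or.inl hs) (Relation.ReflTransGen.single ⟨s, rfl, h⟩)).mp hQ
      rw [hstep h, ih, crossing, if_pos ⟨hQ, hR⟩, add_sub_cancel]
  have hwall : ∀ P, SameWall Γ IEquivalent i K P → (F P).2 = Finsupp.single (coord i P) 1 := by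
    intro P hP
    induction hP with
    | refl => rw [hFK]
    | @tail P Q hKP h ih =>
      obtain ⟨j, -, h⟩ := h
      by_cases hji : j = i
      · subst hji
        exact hcross h hKP ih
      · rw [← hconst h (Or.inl hji), ih, coord_eq_of_iEquivalent (fun h => hji h.symm) h]
  have hsingle : ∀ P, ∃ x, (F P).2 = Finsupp.single x 1 := by
    intro P
    induction connected K P with
    | refl => exact ⟨_, congrArg Prod.snd hFK⟩
    | @tail P Q _ h ih =>
      obtain ⟨j, h⟩ := h
      -- Only a step of type i inside the wall changes the potential, and there its value is already
      -- known.
      by_cases hP : j = i ∧ SameWall Γ IEquivalent i K P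
      · obtain ⟨rfl, hP⟩ := hP
        exact ⟨_, hwall Q ((sameWall_iff (Or.inl rfl) h).mp hP)⟩
      · rw [← hconst h (not_and_or.mp hP)]
        exact ih
  choose sec hsec using hsingle
  have hinj : ∀ {x y : Factor Φ base i},
      (Finsupp.single x 1 : Factor Φ base i →₀ ℤ) = Finsupp.single y 1 → x = y :=
    fun h => Finsupp.single_left_injective one_ne_zero h
  refine ⟨sec, fun P hP => hinj ?_, fun j P Q h hj => hinj ?_⟩
  · rw [← hsec, hwall P hP]
  · rw [← hsec, ← hsec, hconst h hj]

/-- The chambers of a graph product of buildings form a right-angled chamber system. -/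
noncomputable def system (Γ : SimpleGraph I) (Φ : ∀ i, Building (cs i) (B i)) (base : ∀ i, B i) :
    RightAngledSystem Γ (Chamber Γ Φ base) (Factor Φ base) where
  adj := IEquivalent
  adj_equiv := iEquivalent_equivalence
  coord := coord
  coord_eq := fun h h' => coord_eq_of_iEquivalent h h'
  exists_move := exists_iEquivalent
  eq_of_coord := eq_of_coord_eq
  square := fun h => exists_iEquivalent_square h
  connected := connected
  exists_sector := exists_sector

theorem equivalent_system {s : Σ i, S i} {P Q : Chamber Γ Φ base} :
    (system Γ Φ base).Equivalent (fun _ s => CoverChamber.Equivalent s) s P Q ↔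
      Equivalent s P Q := equivalent_iff_coord.symm

theorem mem_ball_iff {P O : Chamber Γ Φ base} {n : ℕ} :
    P ∈ ball O n ↔ (system Γ Φ base).length O P < n :=
  (system Γ Φ base).length_lt_iff.symm

end

end GraphProduct

theorem mainTheorem6 {I : Type*} (Γ : SimpleGraph I) {S W : I → Type*} [∀ i, Group (W i)]
    {M : ∀ i, CoxeterMatrix (S i)} (cs : ∀ i, CoxeterSystem (M i) (W i)) {B : I → Type*}
    (Φ : ∀ i, Building (cs i) (B i)) (base : ∀ i, B i)
    (C₀ : GraphProduct.Chamber Γ Φ base) (n : ℕ)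
    (g : Equiv.Perm (GraphProduct.ball C₀ n))
    (hg : g ∈ ChamberSystem.aut
      (fun s (C D : GraphProduct.ball C₀ n) => GraphProduct.Equivalent s C.1 D.1)) :
    ∃ f : Equiv.Perm (GraphProduct.Chamber Γ Φ base),
      f ∈ ChamberSystem.aut GraphProduct.Equivalent ∧
        ∀ C : GraphProduct.ball C₀ n, f C.1 = (g C).1 := by
  classical
  by_cases hn : 2 ≤ n
  · let 𝒮 := GraphProduct.system Γ Φ base
    -- The values of G outside the ball are irrelevant.
    let G : GraphProduct.Chamber Γ Φ base → GraphProduct.Chamber Γ Φ base := fun P =>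
      if h : P ∈ GraphProduct.ball C₀ n then (g ⟨P, h⟩).1 else P
    have hGg : ∀ P (h : P ∈ GraphProduct.ball C₀ n), G P = (g ⟨P, h⟩).1 := fun P h => dif_pos h
    have hG : 𝒮.IsBallAut (fun _ s => Realization.CoverChamber.Equivalent s) C₀ n G := by
      constructor
      · intro P hP
        rw [← GraphProduct.mem_ball_iff] at hP ⊢
        rw [hGg P hP]
        exact (g ⟨P, hP⟩).2
      · intro P Q hP hQ h
        rw [← GraphProduct.mem_ball_iff] at hP hQ
        rw [hGg P hP, hGg Q hQ] at h
        exact congrArg Subtype.val (g.injective (Subtype.ext h))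
      · intro Q hQ
        rw [← GraphProduct.mem_ball_iff] at hQ
        obtain ⟨P, hP⟩ := g.surjective ⟨Q, hQ⟩
        refine ⟨P.1, GraphProduct.mem_ball_iff.mp P.2, ?_⟩
        rw [hGg P.1 P.2, hP]
      · intro s P Q hP hQ
        rw [← GraphProduct.mem_ball_iff] at hP hQ
        rw [GraphProduct.equivalent_system, GraphProduct.equivalent_system, hGg P hP, hGg Q hQ]
        exact hg s ⟨P, hP⟩ ⟨Q, hQ⟩
    obtain ⟨f, hf, hfG⟩ := hG.exists_extension (fun {i P Q} h => by
      refine Relation.ReflTransGen.mono ?_ _ _ (show GraphProduct.IEquivalent i P Q from h)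
      rintro P Q ⟨s, hs, h⟩
      exact ⟨s, hs, GraphProduct.equivalent_system.mpr h⟩) hn
    refine ⟨f, fun s P Q => ?_, fun C => ?_⟩
    · rw [← GraphProduct.equivalent_system, ← GraphProduct.equivalent_system]
      exact hf s P Q
    · rw [hfG C.1 (GraphProduct.mem_ball_iff.mp C.2), hGg C.1 C.2]
  -- For n ≤ 1 the ball has no chamber besides the centre, and the identity extends g. Radius 2 is
  -- needed above to read off a permutation at the centre.
  · have hball : ∀ C ∈ GraphProduct.ball C₀ n, C = C₀ := by
      rintro C ⟨k, hk, c, h0, hC, -⟩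
      have : k = 0 := by omega
      rw [← hC, this, h0]
    exact ⟨1, one_mem _, fun C => (hball C.1 C.2).trans (hball _ (g C).2).symm⟩
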